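/- **The problem.** Let $G,H,K$ be groups and let $\xi,\chi$ be probability distributions on $G$ and $H$. An instance of the problem LHN-PKE for $G,H,K,\xi,\chi$ consists of homomorphisms $\varphi\colon G\to H$ and $\psi\colon H\to K$ with $Z(H)\not\subseteq\ker\psi$, elements $g_1,\dots,g_m\in G$ sampled via $\xi$, elements $h_1,\dots,h_m\in\ker\psi$ sampled via $\chi$, an element $\tau\in Z(H)\setminus\ker\psi$ of order $2$ sampled via $\chi$, a bit $\beta\in\{0,1\}$, and a word $w=w_1\cdots w_\ell$ over $\{1,\dots,m\}$. The task is to recover $\beta$ from $(g_1,\varphi(g_1)h_1),\dots,(g_m,\varphi(g_m)h_m)$, $\tau$, $g=g_{w_1}\cdots g_{w_\ell}$ and $h=\varphi(g_{w_1})h_{w_1}\cdots\varphi(g_{w_\ell})h_{w_\ell}\,\tau^\beta$. **Computational model.** Algorithms are programs of a unit-cost random access machine with addition, truncated subtraction, halving, comparisons and indirect addressing on natural numbers. Elements of $G$ and of $H$ are represented by arbitrary unique natural numbers, and multiplications and inversions in $G$ and $H$ are instructions of cost $1$. **Theorem.** There is a deterministic classical algorithm (one program for all groups and all instances) with the following property.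 Let $G$ and $H$ be finite abelian groups whose orders have known largest odd factors (given as input), let $K$ be an arbitrary group, and let $\xi,\chi$ be probability distributions on $G$ and $H$. Let $G_2$ and $H_2$ be the Sylow $2$-subgroups of $G$ and $H$. Suppose that a decomposition $H_2=\langle u_1\rangle\oplus\dots\oplus\langle u_k\rangle$ into nontrivial cyclic groups is efficiently computable: the elements $u_j$ and their orders are given, and each coordinate $c_j$ (with $0\le c_j<|\langle u_j\rangle|$) of a given element $u_1^{c_1}\cdots u_k^{c_k}$ of $H_2$ can be computed in time at most $a(\log_2|H|)^b$, where $a,b$ are constants. Then, for every instance of LHN-PKE for $G,H,K,\xi,\chi$ (every possible outcome of the sampling) whose public elements satisfy $G=\langle g_1\rangle\oplus\dots\oplus\langle g_m\rangle$ with all $g_i\ne1$, the algorithm recovers $\beta$ in time $$\mathrm{polylog}(|G|)+\mathrm{polylog}(|H|)+O\!\left(\frac{\log_2|G_2|}{m}\,2^{m/2}\right).$$ Here the polylogarithmic functions depend only on $a,b$, and the implied constant of the last term is absolute. -/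

import Mathlib

universe u v w

/-- `S` is the internal direct sum `⟨a₁⟩ ⊕ ⋯ ⊕ ⟨aₙ⟩` of nontrivial cyclic subgroups. -/
structure IsCyclicDecomposition {A : Type*} [CommGroup A] {n : ℕ} (a : Fin n → A)
    (S : Subgroup A) : Prop where
  ne_one : ∀ i, a i ≠ 1
  indep : iSupIndep fun i => Subgroup.zpowers (a i)
  iSup_eq : ⨆ i, Subgroup.zpowers (a i) = S

/-- The largest odd factor of the order of a finite group. -/
noncomputable def oddPart (A : Type*) [Group A] : ℕ := ordCompl[2] (Nat.card A)

/-- An instance of the LHN-PKE problem for `G, H, K, ξ, χ` with `m` public elements: a possible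
outcome of the sampling of all the (public and secret) data. -/
structure LHNPKE {G : Type*} {H : Type*} (K : Type*) [Group G] [Group H] [Group K]
    (ξ : PMF G) (χ : PMF H) (m : ℕ) where
  /-- secret homomorphism -/
  φ : G →* H
  /-- secret homomorphism -/
  ψ : H →* K
  center_not_le : ¬ Subgroup.center H ≤ ψ.ker
  /-- public elements of `G` -/
  g : Fin m → G
  g_mem : ∀ i, g i ∈ ξ.support
  /-- the secret noise `h₁, …, hₘ` -/
  noise : Fin m → H
  noise_mem : ∀ i, noise i ∈ χ.support
  noise_mem_ker : ∀ i, noise i ∈ ψ.ker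
  /-- public central involution -/
  τ : H
  τ_mem : τ ∈ χ.support
  τ_mem_center : τ ∈ Subgroup.center H
  τ_notMem_ker : τ ∉ ψ.ker
  orderOf_τ : orderOf τ = 2
  /-- the secret bit -/
  β : Fin 2
  /-- the secret word used for the encryption -/
  word : List (Fin m)

namespace LHNPKE

variable {G : Type*} {H : Type*} {K : Type*} [Group G] [Group H] [Group K]
  {ξ : PMF G} {χ : PMF H} {m : ℕ}

/-- Second components `φ(gᵢ) hᵢ` of the public key. -/
def key (I : LHNPKE K ξ χ m) (i : Fin m) : H := I.φ (I.g i) * I.noise i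

/-- First component `g` of the ciphertext. -/
def cipherG (I : LHNPKE K ξ χ m) : G := (I.word.map I.g).prod

/-- Second component `h = h' τ^β` of the ciphertext. -/
def cipherH (I : LHNPKE K ξ χ m) : H := (I.word.map I.key).prod * I.τ ^ (I.β : ℕ)

end LHNPKE

/-- Tests of the random access machine, comparing the contents of two registers. -/
inductive RTest : Type
  | lt (x y : ℕ)
  | eq (x y : ℕ)

/-- Programs of a random access machine with finitely many registers and arrays (both named by
numerals fixed in the program text) holding natural numbers, and with instructions for the
operations of two groups `G` and `H` whose elements are represented by unique numbers. In every
instruction `r, x, y, i` are names of registers and `A` is the name of an array. -/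
inductive RProg : Type
  | skip
  | const (r n : ℕ)
  | copy (r x : ℕ)
  | add (r x y : ℕ)
  | sub (r x y : ℕ)
  | half (r x : ℕ)
  | load (r A i : ℕ)
  | store (A i x : ℕ)
  | mulG (r x y : ℕ)
  | invG (r x : ℕ)
  | mulH (r x y : ℕ)
  | invH (r x : ℕ)
  | coord (r i x : ℕ)
  | seq (p q : RProg)
  | ite (t : RTest) (p q : RProg)
  | loop (t : RTest) (p : RProg)

/-- Contents of the registers and of the arrays. -/
structure RState : Type where
  reg : ℕ → ℕ
  arr : ℕ → ℕ → ℕ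

namespace RState

/-- Write `n` into the register `r`. -/
def setReg (s : RState) (r n : ℕ) : RState :=
  { s with reg := Function.update s.reg r n }

/-- Write `n` into the cell `i` of the array `A`. -/
def setArr (s : RState) (A i n : ℕ) : RState :=
  { s with arr := Function.update s.arr A (Function.update (s.arr A) i n) }

end RState

/-- Value of a test. -/
def RTest.Holds (s : RState) : RTest → Prop
  | .lt x y => s.reg x < s.reg y
  | .eq x y => s.reg x = s.reg y

/-- Access of the machine to the groups: each element of `G` and of `H` has a unique name, and
`gen` is a sequence of elements of `H` with respect to which coordinates can be computed, at the
cost `coordCost` per coordinate. -/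
structure GroupAccess (G : Type*) (H : Type*) where
  encG : G ↪ ℕ
  encH : H ↪ ℕ
  k : ℕ
  gen : Fin k → H
  coordCost : ℕ

/-- `Exec E p s s' t`: started in the state `s`, the program `p` halts in the state `s'`, with
running time `t`. Every elementary instruction (in particular every operation in `G` or `H`) and
every evaluation of a test costs `1`, except for the computation of a coordinate, which costs
`E.coordCost`. An instruction on group elements applied to numbers that are not names of suitable
elements has no successor state. -/
inductive Exec {G : Type*} {H : Type*} [CommGroup G] [CommGroup H] (E : GroupAccess G H) :
    RProg → RState → RState → ℕ → Prop
  | skip (s : RState) : Exec E .skip s s 1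
  | const (s : RState) (r n : ℕ) : Exec E (.const r n) s (s.setReg r n) 1
  | copy (s : RState) (r x : ℕ) : Exec E (.copy r x) s (s.setReg r (s.reg x)) 1
  | add (s : RState) (r x y : ℕ) : Exec E (.add r x y) s (s.setReg r (s.reg x + s.reg y)) 1
  | sub (s : RState) (r x y : ℕ) : Exec E (.sub r x y) s (s.setReg r (s.reg x - s.reg y)) 1
  | half (s : RState) (r x : ℕ) : Exec E (.half r x) s (s.setReg r (s.reg x / 2)) 1
  | load (s : RState) (r A i : ℕ) : Exec E (.load r A i) s (s.setReg r (s.arr A (s.reg i))) 1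
  | store (s : RState) (A i x : ℕ) :
      Exec E (.store A i x) s (s.setArr A (s.reg i) (s.reg x)) 1
  | mulG (s : RState) (r x y : ℕ) (a b : G) (hx : s.reg x = E.encG a) (hy : s.reg y = E.encG b) :
      Exec E (.mulG r x y) s (s.setReg r (E.encG (a * b))) 1
  | invG (s : RState) (r x : ℕ) (a : G) (hx : s.reg x = E.encG a) :
      Exec E (.invG r x) s (s.setReg r (E.encG a⁻¹)) 1
  | mulH (s : RState) (r x y : ℕ) (a b : H) (hx : s.reg x = E.encH a) (hy : s.reg y = E.encH b) :
      Exec E (.mulH r x y) s (s.setReg r (E.encH (a * b))) 1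
  | invH (s : RState) (r x : ℕ) (a : H) (hx : s.reg x = E.encH a) :
      Exec E (.invH r x) s (s.setReg r (E.encH a⁻¹)) 1
  | coord (s : RState) (r i x : ℕ) (j : Fin E.k) (c : Fin E.k → ℕ)
      (hc : ∀ l, c l < orderOf (E.gen l)) (hi : s.reg i = j)
      (hx : s.reg x = E.encH (∏ l, E.gen l ^ c l)) :
      Exec E (.coord r i x) s (s.setReg r (c j)) E.coordCost
  | seq {p q : RProg} {s s' s'' : RState} {t t' : ℕ} (hp : Exec E p s s' t)
      (hq : Exec E q s' s'' t') : Exec E (.seq p q) s s'' (t + t')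
  | ite_true {c : RTest} {p q : RProg} {s s' : RState} {t : ℕ} (hc : c.Holds s)
      (hp : Exec E p s s' t) : Exec E (.ite c p q) s s' (t + 1)
  | ite_false {c : RTest} {p q : RProg} {s s' : RState} {t : ℕ} (hc : ¬ c.Holds s)
      (hq : Exec E q s s' t) : Exec E (.ite c p q) s s' (t + 1)
  | loop_true {c : RTest} {p : RProg} {s s' s'' : RState} {t t' : ℕ} (hc : c.Holds s)
      (hp : Exec E p s s' t) (hl : Exec E (.loop c p) s' s'' t') :
      Exec E (.loop c p) s s'' (t + t' + 1)
  | loop_false {c : RTest} {p : RProg} {s : RState} (hc : ¬ c.Holds s) :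
      Exec E (.loop c p) s s 1

/-- The array whose first cells hold `f 0, …, f (n - 1)`, and whose other cells hold `0`. -/
def listArray {n : ℕ} (f : Fin n → ℕ) (i : ℕ) : ℕ := if h : i < n then f ⟨i, h⟩ else 0

/-- The input of an attack. Registers `0, …, 6`: `m`, `k`, the odd parts of `|G|` and `|H|`, and
the names of `τ` and of the two components of the ciphertext. Arrays `0, …, 3`: the names of the
`gᵢ`, the names of the `φ(gᵢ) hᵢ`, the names of the generators of the cyclic summands of the Sylow
`2`-subgroup of `H`, and their orders. All other cells hold `0`. -/
noncomputable def attackInput {G : Type*} {H : Type*} {K : Type*} [CommGroup G] [CommGroup H]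
    [Group K] {ξ : PMF G} {χ : PMF H} {m : ℕ} (E : GroupAccess G H) (I : LHNPKE K ξ χ m) :
    RState where
  reg
    | 0 => m
    | 1 => E.k
    | 2 => oddPart G
    | 3 => oddPart H
    | 4 => E.encH I.τ
    | 5 => E.encG I.cipherG
    | 6 => E.encH I.cipherH
    | _ => 0
  arr
    | 0 => listArray fun i => E.encG (I.g i)
    | 1 => listArray fun i => E.encH (I.key i)
    | 2 => listArray fun j => E.encH (E.gen j)
    | 3 => listArray fun j => orderOf (E.gen j)
    | _ => fun _ => 0

/-!
The attack rests on the subgroup `S` of `G × H` generated by the pairs of public elements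
`(gᵢ, φ(gᵢ) hᵢ)`, raised to the product of the odd parts of `|G|` and `|H|`, so that all elements
lie in the Sylow `2`-subgroups. Every pair `(x, y)` in `S` satisfies `ψ y = ψ (φ x)`, so `(1, τ)`
is not in `S`; on the other hand the ciphertext `(g, h)`, raised to the same odd exponent, satisfies
`(g, h τ ^ β) ∈ S`. It remains to decide which of `(g, h)` and `(g, h τ)` lies in `S`.

Write `xᵢ` for the first components of the generators and `2 ^ eᵢ` for their orders. The ciphertext
is multiplied by elements of `S` until its first component is trivial (`Attack.level_run`). If the
first component `y` satisfies `y ^ 2 ^ (t + 1) = 1`, then `y ^ 2 ^ t` is a product of some of the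
involutions `xᵢ ^ 2 ^ (eᵢ - 1)` with `eᵢ > t`, because the `xᵢ` are independent. Which ones is found
by meeting in the middle: the products of one half of the involutions are entered into a table that
is addressed by the names of the elements, and the products of the other half are looked up in it.
With `r` involutions this takes time `O(2 ^ (r / 2))`. The numbers `r` of all levels add up to
`∑ eᵢ ≤ log₂ |G₂|`, and `2 ^ (r / 2) / r` is increasing up to a constant factor
(`Attack.two_pow_half_le`), which gives the last term of the bound (`Attack.sum_two_pow_half_le`).

When the first component is `1`, the question is whether the second component lies in the fibre of
`S` over `1`, which is the subgroup of `H₂` generated by the `2 ^ eᵢ`-th powers of the second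
components of the generators (`Attack.KeyData.one_mem_iff`). This is decided by elimination in the
abelian `2`-group `H₂`: the binary digits of the coordinates define a filtration of `H₂` with
factors of order at most `2` (`Attack.digitFiltration`), and an echelon table with respect to it,
closed under squaring in the sense of `Attack.IsEchelon`, decides membership in the subgroup that it
spans (`Attack.IsEchelon.reduce`, `Attack.InsertInv.isEchelon`).

The programs are verified in a Hoare logic for total correctness with time bounds: `Run E p s T Q`
says that `p`, started in `s`, halts within time `T` in a state satisfying `Q`.
-/

/-! ### Total correctness of programs with time bounds -/

namespace RState

@[simp] theorem reg_setReg_self (s : RState) (r n : ℕ) : (s.setReg r n).reg r = n := by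
  simp [setReg]

@[simp] theorem reg_setReg_of_ne (s : RState) {r x : ℕ} (n : ℕ) (h : x ≠ r) :
    (s.setReg r n).reg x = s.reg x := by
  simp [setReg, h]

@[simp] theorem arr_setReg (s : RState) (r n : ℕ) : (s.setReg r n).arr = s.arr := rfl

@[simp] theorem reg_setArr (s : RState) (A i n : ℕ) : (s.setArr A i n).reg = s.reg := rfl

@[simp] theorem arr_setArr_self (s : RState) (A i n : ℕ) :
    (s.setArr A i n).arr A = Function.update (s.arr A) i n := by
  simp [setArr]

@[simp] theorem arr_setArr_of_ne (s : RState) {A B : ℕ} (i n : ℕ) (h : B ≠ A) :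
    (s.setArr A i n).arr B = s.arr B := by
  simp [setArr, h]

end RState

/-- Sequential composition of a list of programs. -/
def block : List RProg → RProg
  | [] => .skip
  | p :: ps => .seq p (block ps)

/-- `Run E p s T Q`: started in the state `s`, the program `p` halts within time `T` in a state
that satisfies `Q`. -/
def Run {G H : Type*} [CommGroup G] [CommGroup H] (E : GroupAccess G H) (p : RProg) (s : RState)
    (T : ℕ) (Q : RState → Prop) : Prop :=
  ∃ s' t, Exec E p s s' t ∧ t ≤ T ∧ Q s'

namespace Run

variable {G H : Type*} [CommGroup G] [CommGroup H] {E : GroupAccess G H} {p q : RProg}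
  {ps : List RProg} {s : RState} {T T' : ℕ} {Q Q' : RState → Prop} {c : RTest}

theorem mono (h : Run E p s T Q) (hT : T ≤ T') (hQ : ∀ s', Q s' → Q' s') : Run E p s T' Q' := by
  obtain ⟨s', t, h1, h2, h3⟩ := h
  exact ⟨s', t, h1, h2.trans hT, hQ _ h3⟩

theorem le (h : Run E p s T Q) (hT : T ≤ T') : Run E p s T' Q := h.mono hT fun _ => id

theorem skip (h : Q s) : Run E .skip s 1 Q := ⟨s, 1, .skip s, le_rfl, h⟩

theorem nil (h : Q s) : Run E (block []) s 1 Q := skip h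

theorem cons (hp : Run E p s T Q') (hq : ∀ s', Q' s' → Run E (block ps) s' T' Q) :
    Run E (block (p :: ps)) s (T + T') Q := by
  obtain ⟨s', t, h1, h2, h3⟩ := hp
  obtain ⟨s'', t', h4, h5, h6⟩ := hq s' h3
  exact ⟨s'', t + t', .seq h1 h4, by omega, h6⟩

/-- Symbolic execution of the instruction at the head of a block, as in the rules below. -/
theorem const {r n : ℕ} (h : Run E (block ps) (s.setReg r n) T Q) :
    Run E (block (.const r n :: ps)) s (1 + T) Q :=
  cons (Q' := fun s' => s' = s.setReg r n) ⟨_, 1, .const s r n, le_rfl, rfl⟩ fun _ h' => h' ▸ h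

theorem copy {r x : ℕ} (h : Run E (block ps) (s.setReg r (s.reg x)) T Q) :
    Run E (block (.copy r x :: ps)) s (1 + T) Q :=
  cons (Q' := fun s' => s' = _) ⟨_, 1, .copy s r x, le_rfl, rfl⟩ fun _ h' => h' ▸ h

theorem add {r x y : ℕ} (h : Run E (block ps) (s.setReg r (s.reg x + s.reg y)) T Q) :
    Run E (block (.add r x y :: ps)) s (1 + T) Q :=
  cons (Q' := fun s' => s' = _) ⟨_, 1, .add s r x y, le_rfl, rfl⟩ fun _ h' => h' ▸ h

theorem sub {r x y : ℕ} (h : Run E (block ps) (s.setReg r (s.reg x - s.reg y)) T Q) :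
    Run E (block (.sub r x y :: ps)) s (1 + T) Q :=
  cons (Q' := fun s' => s' = _) ⟨_, 1, .sub s r x y, le_rfl, rfl⟩ fun _ h' => h' ▸ h

theorem half {r x : ℕ} (h : Run E (block ps) (s.setReg r (s.reg x / 2)) T Q) :
    Run E (block (.half r x :: ps)) s (1 + T) Q :=
  cons (Q' := fun s' => s' = _) ⟨_, 1, .half s r x, le_rfl, rfl⟩ fun _ h' => h' ▸ h

theorem load {r A i : ℕ} (h : Run E (block ps) (s.setReg r (s.arr A (s.reg i))) T Q) :
    Run E (block (.load r A i :: ps)) s (1 + T) Q :=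
  cons (Q' := fun s' => s' = _) ⟨_, 1, .load s r A i, le_rfl, rfl⟩ fun _ h' => h' ▸ h

theorem store {A i x : ℕ} (h : Run E (block ps) (s.setArr A (s.reg i) (s.reg x)) T Q) :
    Run E (block (.store A i x :: ps)) s (1 + T) Q :=
  cons (Q' := fun s' => s' = _) ⟨_, 1, .store s A i x, le_rfl, rfl⟩ fun _ h' => h' ▸ h

theorem mulG {r x y : ℕ} (a b : G) (hx : s.reg x = E.encG a) (hy : s.reg y = E.encG b)
    (h : Run E (block ps) (s.setReg r (E.encG (a * b))) T Q) :
    Run E (block (.mulG r x y :: ps)) s (1 + T) Q :=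
  cons (Q' := fun s' => s' = _) ⟨_, 1, .mulG s r x y a b hx hy, le_rfl, rfl⟩ fun _ h' => h' ▸ h

theorem invG {r x : ℕ} (a : G) (hx : s.reg x = E.encG a)
    (h : Run E (block ps) (s.setReg r (E.encG a⁻¹)) T Q) :
    Run E (block (.invG r x :: ps)) s (1 + T) Q :=
  cons (Q' := fun s' => s' = _) ⟨_, 1, .invG s r x a hx, le_rfl, rfl⟩ fun _ h' => h' ▸ h

theorem mulH {r x y : ℕ} (a b : H) (hx : s.reg x = E.encH a) (hy : s.reg y = E.encH b)
    (h : Run E (block ps) (s.setReg r (E.encH (a * b))) T Q) :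
    Run E (block (.mulH r x y :: ps)) s (1 + T) Q :=
  cons (Q' := fun s' => s' = _) ⟨_, 1, .mulH s r x y a b hx hy, le_rfl, rfl⟩ fun _ h' => h' ▸ h

theorem coord {r i x : ℕ} (j : Fin E.k) (c : Fin E.k → ℕ)
    (hc : ∀ l, c l < orderOf (E.gen l)) (hi : s.reg i = j)
    (hx : s.reg x = E.encH (∏ l, E.gen l ^ c l))
    (h : Run E (block ps) (s.setReg r (c j)) T Q) :
    Run E (block (.coord r i x :: ps)) s (E.coordCost + T) Q :=
  cons (Q' := fun s' => s' = _) ⟨_, _, .coord s r i x j c hc hi hx, le_rfl, rfl⟩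
    fun _ h' => h' ▸ h

theorem ite (ht : c.Holds s → Run E p s T Q) (hf : ¬ c.Holds s → Run E q s T Q) :
    Run E (.ite c p q) s (T + 1) Q := by
  by_cases h : c.Holds s
  · obtain ⟨s', t, h1, h2, h3⟩ := ht h
    exact ⟨s', t + 1, .ite_true h h1, by omega, h3⟩
  · obtain ⟨s', t, h1, h2, h3⟩ := hf h
    exact ⟨s', t + 1, .ite_false h h1, by omega, h3⟩

/-- Rule for a loop whose number `n` of iterations is known beforehand. -/
theorem loop_count (I : ℕ → RState → Prop) (cost : ℕ → ℕ) (n : ℕ)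
    (htest : ∀ j s, j ≤ n → I j s → (c.Holds s ↔ j < n))
    (hbody : ∀ j s, j < n → I j s → Run E p s (cost j) (I (j + 1))) (h0 : I 0 s) :
    Run E (.loop c p) s (∑ j ∈ Finset.range n, (cost j + 1) + 1) (I n) := by
  have key : ∀ d j s, j + d = n → I j s →
      Run E (.loop c p) s (∑ i ∈ Finset.range d, (cost (j + i) + 1) + 1) (I n) := by
    intro d
    induction d with
    | zero =>
      intro j s hj hI
      have : ¬ c.Holds s := by rw [htest j s (by omega) hI]; omega
      obtain rfl : j = n := by omega
      exact ⟨s, 1, .loop_false this, by simp, hI⟩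
    | succ d ih =>
      intro j s hj hI
      have hc : c.Holds s := by rw [htest j s (by omega) hI]; omega
      obtain ⟨s', t, h1, h2, h3⟩ := hbody j s (by omega) hI
      obtain ⟨s'', t', h4, h5, h6⟩ := ih (j + 1) s' (by omega) h3
      refine ⟨s'', t + t' + 1, .loop_true hc h1 h4, ?_, h6⟩
      rw [Finset.sum_range_succ']
      simp only [add_zero, Nat.add_right_comm j 1, Nat.add_assoc] at h5 ⊢
      omega
  simpa using key n 0 s (by omega) h0

theorem loop_count_const (I : ℕ → RState → Prop) (cost : ℕ) (n : ℕ)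
    (htest : ∀ j s, j ≤ n → I j s → (c.Holds s ↔ j < n))
    (hbody : ∀ j s, j < n → I j s → Run E p s cost (I (j + 1))) (h0 : I 0 s) :
    Run E (.loop c p) s (n * (cost + 1) + 1) (I n) := by
  simpa using loop_count I (fun _ => cost) n htest hbody h0

/-- Rule for a loop that terminates because the variant `V` decreases. -/
theorem loop_variant (I : RState → Prop) (V : RState → ℕ) (cost : ℕ)
    (hbody : ∀ s, I s → c.Holds s → Run E p s cost (fun s' => I s' ∧ V s' < V s)) (h0 : I s) :
    Run E (.loop c p) s (V s * (cost + 1) + 1) (fun s' => I s' ∧ ¬ c.Holds s') := by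
  have key : ∀ d s, V s ≤ d → I s →
      Run E (.loop c p) s (d * (cost + 1) + 1) (fun s' => I s' ∧ ¬ c.Holds s') := by
    intro d
    induction d with
    | zero =>
      intro s hd hI
      by_cases hc : c.Holds s
      · obtain ⟨s', t, h1, h2, h3⟩ := hbody s hI hc
        omega
      · exact ⟨s, 1, .loop_false hc, by simp, hI, hc⟩
    | succ d ih =>
      intro s hd hI
      by_cases hc : c.Holds s
      · obtain ⟨s', t, h1, h2, h3, h7⟩ := hbody s hI hc
        obtain ⟨s'', t', h4, h5, h6⟩ := ih s' (by omega) h3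
        refine ⟨s'', t + t' + 1, .loop_true hc h1 h4, ?_, h6⟩
        rw [Nat.succ_mul]
        omega
      · exact ⟨s, 1, .loop_false hc, by simp, hI, hc⟩
  exact key _ s le_rfl h0

end Run

@[simp] theorem RTest.holds_lt {s : RState} {x y : ℕ} :
    (RTest.lt x y).Holds s ↔ s.reg x < s.reg y := Iff.rfl

@[simp] theorem RTest.holds_eq {s : RState} {x y : ℕ} :
    (RTest.eq x y).Holds s ↔ s.reg x = s.reg y := Iff.rfl

/-! ### The program -/

namespace Attack

/-- Simultaneous power of the elements of `G` and `H` in the registers `14` and `15`, with the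
exponent in register `16`, by repeated squaring. -/
def powPair : RProg := block [
  .copy 17 8, .copy 18 9,
  .loop (.lt 11 16) (block [
    .half 19 16, .add 20 19 19,
    .ite (.lt 20 16) (block [.mulG 17 17 14, .mulH 18 18 15]) (block []),
    .mulG 14 14 14, .mulH 15 15 15, .copy 16 19]),
  .copy 14 17, .copy 15 18]

/-- The names of the identities are computed, and the ciphertext is appended to the lists of the
public elements. -/
def prologue : RProg := block [
  .const 7 1, .invG 8 5, .mulG 8 8 5, .mulH 9 4 4, .add 10 0 7, .store 0 0 5, .store 1 0 6]

/-- All listed pairs are raised to the product of the odd parts of `|G|` and `|H|`. -/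
def oddPhase : RProg := block [
  .loop (.lt 13 10) (block [
    .load 14 0 13, .load 15 1 13, .copy 16 2, powPair, .copy 16 3, powPair,
    .store 0 13 14, .store 1 13 15, .add 13 13 7])]

/-- Register `12` receives a number `T` such that the `2 ^ T`-th powers of the listed elements of
`G` are trivial. In the inner loop, register `15` vanishes if and only if the names in the registers
`14` and `8` agree: it is the sum of the two truncated differences. -/
def exponentPhase : RProg := block [
  .const 13 0,
  .loop (.lt 13 0) (block [
    .load 14 0 13, .const 15 1,
    .loop (.lt 11 15) (block [
      .mulG 14 14 14, .add 12 12 7, .sub 15 14 8, .sub 16 8 14, .add 15 15 16]),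
    .add 13 13 7])]

/-- Register `17` receives the `2 ^ t`-th power of the element of `G` in register `15`, where `t`
is the content of register `12`. -/
def iteratedSquare : RProg := block [
  .copy 17 15, .copy 20 12,
  .loop (.lt 11 20) (block [.mulG 17 17 17, .sub 20 20 7])]

/-- The pairs whose `2 ^ t`-th power is nontrivial are copied into the arrays `6`, `7`, `8`, and
are squared. Register `14` counts them. -/
def collect : RProg := block [
  .const 13 0, .const 14 0,
  .loop (.lt 13 0) (block [
    .load 15 0 13, .load 16 1 13, iteratedSquare,
    .ite (.eq 17 8) (block []) (block [
      .store 6 14 17, .store 7 14 15, .store 8 14 16, .mulG 15 15 15, .mulH 16 16 16,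
      .store 0 13 15, .store 1 13 16, .add 14 14 7]),
    .add 13 13 7])]

/-- The products of the triple in the registers `17`, `15`, `16` with all subproducts of the
collected triples from register `18` up to register `21` are appended to the table in the arrays
`9`, `10`, `11`, whose length is in register `20`. -/
def buildTable : RProg := block [
  .copy 19 20, .store 9 20 17, .store 10 20 15, .store 11 20 16, .add 20 20 7,
  .loop (.lt 18 21) (block [
    .load 24 6 18, .load 25 7 18, .load 26 8 18, .copy 23 19, .copy 27 20,
    .loop (.lt 23 27) (block [
      .load 28 9 23, .mulG 28 28 24, .store 9 20 28,
      .load 28 10 23, .mulG 28 28 25, .store 10 20 28,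
      .load 28 11 23, .mulH 28 28 26, .store 11 20 28,
      .add 20 20 7, .add 23 23 7]),
    .add 18 18 7])]

/-- The positions of the entries of the first table are recorded in the array `12` under their
names. Old records are not deleted, so every record has to be verified when it is read. -/
def fillDirectory : RProg := block [
  .const 23 0,
  .loop (.lt 23 22) (block [.load 24 9 23, .store 12 24 23, .add 23 23 7])]

/-- For each entry of the second table, an equal entry of the first table is looked up. When there
is one, the products of the other two columns replace the ciphertext. -/
def scanTable : RProg := block [
  .loop (.lt 23 20) (block [
    .load 24 9 23, .load 25 12 24,
    .ite (.lt 25 22) (block [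
      .load 26 9 25,
      .ite (.eq 26 24) (block [
        .load 27 10 25, .load 28 10 23, .mulG 27 27 28, .store 0 0 27,
        .load 27 11 25, .load 28 11 23, .mulH 27 27 28, .store 1 0 27]) (block [])]) (block []),
    .add 23 23 7])]

/-- If the `2 ^ (t + 1)`-th power of the first component of the ciphertext is trivial, where `t + 1`
is the content of register `12`, then the ciphertext is multiplied by an element of the group
generated by the listed pairs so that the `2 ^ t`-th power becomes trivial. -/
def level : RProg := block [
  .sub 12 12 7, collect,
  .load 15 0 0, .load 16 1 0, iteratedSquare,
  .const 18 0, .const 20 0, .half 21 14, buildTable,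
  .copy 22 20, .copy 17 8, .copy 15 8, .copy 16 9, .copy 21 14, buildTable,
  fillDirectory, scanTable]

/-- The element of `H` in register `14` is inserted into the echelon table in the arrays `4`
(elements) and `5` (marks of the occupied cells). Register `15` tells whether the table has
grown. Register `18` runs through the cells, that is, through the binary digits of the coordinates;
register `16` is the number of the coordinate and register `17` the weight of the digit. When the
element is stored in an empty cell, the insertion goes on with its square. -/
def insert : RProg := block [
  .const 15 0, .const 16 0, .const 17 1, .const 18 0,
  .loop (.lt 16 1) (block [
    .coord 19 16 14, .copy 20 17,
    .loop (.lt 7 20) (block [.half 19 19, .half 20 20]),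
    .half 21 19, .add 21 21 21,
    .ite (.lt 21 19) (block [
      .load 22 5 18,
      .ite (.eq 22 7) (block []) (block [.store 4 18 14, .store 5 18 7, .const 15 1]),
      .load 22 4 18, .mulH 14 14 22]) (block []),
    .add 17 17 17, .add 18 18 7, .load 23 3 16,
    .ite (.eq 17 23) (block [.const 17 1, .add 16 16 7]) (block [])])]

/-- The second components are inserted into the echelon table, the ciphertext last. The result is
`1` if the ciphertext makes the table grow, that is, if it is not generated by the others. -/
def siftPhase : RProg := block [
  .const 13 0,
  .loop (.lt 13 10) (block [.load 14 1 13, insert, .add 13 13 7]),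
  .copy 0 15]

/-- The attack: reduction to the Sylow `2`-subgroups, removal of the first component of the
ciphertext digit by digit, and a membership test for what is left of the second component. -/
def program : RProg := block [
  prologue, oddPhase, exponentPhase, .loop (.lt 11 12) level, siftPhase]

end Attack

namespace Attack

variable {G H : Type*} [CommGroup G] [CommGroup H] {E : GroupAccess G H}

/-! ### Odd powers and exponents -/

theorem size_half_lt {n : ℕ} (hn : 0 < n) : (n / 2).size < n.size := by
  rw [Nat.lt_size]
  rcases h : (n / 2).size with _ | k
  · simp; omega
  · have : 2 ^ k ≤ n / 2 := by rw [← Nat.lt_size]; omega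
    rw [pow_succ]
    omega

theorem pow_eq_half {M : Type*} [Monoid M] (a : M) (n : ℕ) :
    a ^ n = (a * a) ^ (n / 2) * a ^ (n % 2) := by
  conv_lhs => rw [← Nat.div_add_mod n 2]
  rw [pow_add, pow_mul, pow_two]

theorem powPair_run {s : RState} {a : G} {b : H} {n L : ℕ} (h8 : s.reg 8 = E.encG 1)
    (h9 : s.reg 9 = E.encH 1) (h11 : s.reg 11 = 0) (h14 : s.reg 14 = E.encG a)
    (h15 : s.reg 15 = E.encH b) (h16 : s.reg 16 = n) (hn : n < 2 ^ L) :
    Run E powPair s (11 * L + 6) (fun s' => s'.reg 14 = E.encG (a ^ n) ∧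
      s'.reg 15 = E.encH (b ^ n) ∧ (∀ r < 14, s'.reg r = s.reg r) ∧ s'.arr = s.arr) := by
  have hL : n.size ≤ L := Nat.size_le.2 hn
  refine Run.le (T := 1 + (1 + (n.size * (10 + 1) + 1 + (1 + (1 + 1))))) ?_ (by omega)
  -- Invariant of the loop: accumulator times base to the remaining exponent is the final result.
  refine Run.copy (Run.copy (Run.cons (Q' := fun s' =>
    (∃ (a' : G) (b' : H) (c : G) (d : H), s'.reg 14 = E.encG a' ∧ s'.reg 15 = E.encH b' ∧
      s'.reg 17 = E.encG c ∧
      s'.reg 18 = E.encH d ∧ c * a' ^ s'.reg 16 = a ^ n ∧ d * b' ^ s'.reg 16 = b ^ n ∧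
      (∀ r < 14, s'.reg r = s.reg r) ∧ s'.arr = s.arr) ∧ ¬ 0 < s'.reg 16) ?_ ?_))
  · refine Run.mono (Run.loop_variant (E := E) (fun s' =>
      ∃ (a' : G) (b' : H) (c : G) (d : H), s'.reg 14 = E.encG a' ∧ s'.reg 15 = E.encH b' ∧
      s'.reg 17 = E.encG c ∧
        s'.reg 18 = E.encH d ∧ c * a' ^ s'.reg 16 = a ^ n ∧ d * b' ^ s'.reg 16 = b ^ n ∧
        (∀ r < 14, s'.reg r = s.reg r) ∧ s'.arr = s.arr) (fun s' => (s'.reg 16).size) 10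
        ?_ ?_) ?_ ?_
    · rintro s1 ⟨a', b', c, d, i14, i15, i17, i18, hc, hd, hr, ha⟩ ht
      have ht : 0 < s1.reg 16 := by simpa [hr 11, h11] using ht
      refine Run.le (T := 1 + (1 + (3 + 1 + (1 + (1 + (1 + 1)))))) ?_ (by omega)
      refine Run.half (Run.add (Run.cons
        (Q' := fun s' => s'.reg 14 = E.encG a' ∧ s'.reg 15 = E.encH b' ∧
          s'.reg 17 = E.encG (c * a' ^ (s1.reg 16 % 2)) ∧
          s'.reg 18 = E.encH (d * b' ^ (s1.reg 16 % 2)) ∧ s'.reg 19 = s1.reg 16 / 2 ∧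
          (∀ r < 14, s'.reg r = s.reg r) ∧ s'.arr = s.arr) ?_ ?_) )
      · refine Run.ite (fun h => ?_) (fun h => ?_)
        · simp at h
          have h1 : s1.reg 16 % 2 = 1 := by omega
          refine Run.mulG c a' (by simp [i17]) (by simp [i14]) (Run.mulH d b' (by simp [i18])
            (by simp [i15]) (Run.nil ?_))
          simp [i14, i15, h1, ha]
          intro r hr'
          simp (disch := omega) [hr]
        · simp at h
          have h1 : s1.reg 16 % 2 = 0 := by omega
          refine (Run.nil ?_).le (show 1 ≤ 3 by omega)
          simp [i14, i15, i17, i18, h1, ha]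
          intro r hr'
          simp (disch := omega) [hr]
      · rintro s2 ⟨j14, j15, j17, j18, j19, jr, ja⟩
        refine Run.mulG a' a' (by simp [j14]) (by simp [j14]) (Run.mulH b' b' (by simp [j15])
            (by simp [j15]) (Run.copy (Run.nil ?_)))
        refine ⟨⟨a' * a', b' * b', _, _, by simp, by simp, by simp [j17]; rfl,
          by simp [j18]; rfl, ?_, ?_, ?_, by simp [ja]⟩, ?_⟩
        · simp only [RState.reg_setReg_self]
          rw [← hc, pow_eq_half a' (s1.reg 16)]
          simp [j19, mul_assoc, mul_comm]
        · simp only [RState.reg_setReg_self]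
          rw [← hd, pow_eq_half b' (s1.reg 16)]
          simp [j19, mul_assoc, mul_comm]
        · intro r hr'
          simp (disch := omega) [jr]
        · simp [j19, size_half_lt ht]
    · refine ⟨a, b, 1, 1, ?_⟩
      simp [h14, h15, h8, h9, h16]
      intro r hr'
      simp (disch := omega)
    · simp [h16]
    · rintro s' ⟨⟨a', b', c, d, i14, i15, i17, i18, hc, hd, hr, ha⟩, h⟩
      refine ⟨⟨a', b', c, d, i14, i15, i17, i18, hc, hd, hr, ha⟩, ?_⟩
      simpa [hr 11, h11] using h
  · rintro s' ⟨⟨a', b', c, d, i14, i15, i17, i18, hc, hd, hr, ha⟩, h⟩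
    have h0 : s'.reg 16 = 0 := by omega
    refine Run.copy (Run.copy (Run.nil ?_))
    simp [h0] at hc hd
    simp [i17, i18, hc, hd, ha]
    intro r hr'
    simp (disch := omega) [hr]

theorem update_eq_ite {α : Type*} (f : ℕ → α) (i : ℕ) (a : α) (j : ℕ) :
    Function.update f i a j = if j = i then a else f j := by
  simp [Function.update_apply]

theorem oddPhase_run {s : RState} {A : ℕ → G} {B : ℕ → H} {M N L n : ℕ}
    (h7 : s.reg 7 = 1) (h8 : s.reg 8 = E.encG 1)
    (h9 : s.reg 9 = E.encH 1) (h11 : s.reg 11 = 0) (h13 : s.reg 13 = 0) (h2 : s.reg 2 = M)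
    (h3 : s.reg 3 = N)
    (h10 : s.reg 10 = n) (hM : M < 2 ^ L) (hN : N < 2 ^ L)
    (hA : ∀ i < n, s.arr 0 i = E.encG (A i)) (hB : ∀ i < n, s.arr 1 i = E.encH (B i)) :
    Run E oddPhase s (n * (22 * L + 21) + 2) (fun s' =>
      (∀ i < n, s'.arr 0 i = E.encG (A i ^ (M * N))) ∧
      (∀ i < n, s'.arr 1 i = E.encH (B i ^ (M * N))) ∧
      (∀ r < 13, s'.reg r = s.reg r) ∧ ∀ X, 2 ≤ X → s'.arr X = s.arr X) := by
  refine Run.cons (T := n * (22 * L + 20 + 1) + 1) (T' := 1) (Q' := _)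
    (Run.loop_count_const (fun j s' => s'.reg 13 = j ∧
      (∀ i < n, s'.arr 0 i = E.encG (if i < j then A i ^ (M * N) else A i)) ∧
      (∀ i < n, s'.arr 1 i = E.encH (if i < j then B i ^ (M * N) else B i)) ∧
      (∀ r < 13, s'.reg r = s.reg r) ∧ ∀ X, 2 ≤ X → s'.arr X = s.arr X)
      (22 * L + 20) n ?_ ?_ ?_) ?_
  · rintro j s1 hj ⟨i13, -, -, hr, -⟩
    simp [hr 10, h10, i13]
  · rintro j s1 hj ⟨i13, i0, i1, hr, ha⟩
    refine Run.le (T := 1 + (1 + (1 + (11 * L + 6 + (1 + (11 * L + 6 + (1 + (1 + (1 + 1))))))))) ?_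
      (by omega)
    refine Run.load (Run.load (Run.copy (Run.cons (powPair_run (a := A j) (b := B j) (n := M)
      ?_ ?_ ?_ ?_ ?_ ?_ hM) ?_)))
    · simp [hr 8, h8]
    · simp [hr 9, h9]
    · simp [hr 11, h11]
    · simp [i0 j hj, i13]
    · simp [i1 j hj, i13]
    · simp [hr 2, h2]
    rintro s2 ⟨j14, j15, jr, ja⟩
    refine Run.copy (Run.cons (powPair_run (a := A j ^ M) (b := B j ^ M) (n := N)
      ?_ ?_ ?_ ?_ ?_ ?_ hN) ?_)
    · simp [jr 8, hr 8, h8]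
    · simp [jr 9, hr 9, h9]
    · simp [jr 11, hr 11, h11]
    · simp [j14]
    · simp [j15]
    · simp [jr 3, hr 3, h3]
    rintro s3 ⟨k14, k15, kr, ka⟩
    have e13 : s3.reg 13 = j := by simp [kr 13, jr 13, i13]
    refine Run.store (Run.store (Run.add (Run.nil ⟨?_, ?_, ?_, ?_, ?_⟩)))
    · simp [e13, kr 7, jr 7, hr 7, h7]
    · intro i hi
      simp only [RState.arr_setReg, RState.arr_setArr_of_ne, RState.arr_setArr_self, ne_eq,
        zero_ne_one, not_false_eq_true, update_eq_ite, e13, k14, ka, ja, i0 i hi, ← pow_mul]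
      rcases lt_trichotomy i j with h | rfl | h
      · simp [h, h.ne, h.trans (Nat.lt_succ_self j)]
      · simp
      · simp [h.ne', h.not_gt, show ¬ i < j + 1 by omega]
    · intro i hi
      simp only [RState.arr_setReg, RState.arr_setArr_of_ne, RState.arr_setArr_self, ne_eq,
        one_ne_zero, not_false_eq_true, update_eq_ite, RState.reg_setArr, e13, k15, ka, ja,
        i1 i hi, ← pow_mul]
      rcases lt_trichotomy i j with h | rfl | h
      · simp [h, h.ne, h.trans (Nat.lt_succ_self j)]
      · simp
      · simp [h.ne', h.not_gt, show ¬ i < j + 1 by omega]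
    · intro r hr'
      simp (disch := omega) [kr, jr, hr]
    · intro X hX
      simp (disch := omega) [ka, ja, ha X hX]
  · refine ⟨h13, ?_, ?_, fun _ _ => rfl, fun _ _ => rfl⟩ <;> simpa
  · rintro s' ⟨i13, i0, i1, hr, ha⟩
    refine Run.nil ⟨fun i hi => ?_, fun i hi => ?_, hr, ha⟩
    · simp [i0 i hi, hi]
    · simp [i1 i hi, hi]

theorem exponentPhase_run {s : RState} {A : ℕ → G} {L m : ℕ}
    (h0 : s.reg 0 = m) (h7 : s.reg 7 = 1) (h8 : s.reg 8 = E.encG 1) (h11 : s.reg 11 = 0)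
    (h12 : s.reg 12 = 0) (hA : ∀ i < m, s.arr 0 i = E.encG (A i))
    (hL : ∀ i < m, A i ^ 2 ^ L = 1) :
    Run E exponentPhase s (m * (7 * L + 13) + 3) (fun s' => ∃ T,
      s'.reg 12 = T ∧ T ≤ m * (L + 1) ∧ (∀ i < m, A i ^ 2 ^ T = 1) ∧
      (∀ r < 12, s'.reg r = s.reg r) ∧ s'.arr = s.arr) := by
  refine Run.le (T := 1 + ((m * (7 * L + 12 + 1) + 1) + 1)) ?_ (le_of_eq (by ring))
  refine Run.const (Run.cons (Q' := _) (Run.loop_count_const (fun j s' => s'.reg 13 = j ∧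
      s'.reg 12 ≤ j * (L + 1) ∧ (∀ i < j, A i ^ 2 ^ s'.reg 12 = 1) ∧
      (∀ r < 12, s'.reg r = s.reg r) ∧ s'.arr = s.arr) (7 * L + 12) m ?_ ?_ ?_) ?_)
  · rintro j s1 hj ⟨i13, -, -, hr, -⟩
    simp [hr 0, h0, i13]
  · rintro j s1 hj ⟨i13, i12, hi, hr, ha⟩
    refine Run.le (T := 1 + (1 + (((L + 1) * (6 + 1) + 1) + (1 + 1)))) ?_ (by omega)
    -- Register `15` is `1` at first, so that even the identity is squared once: hence `L + 1`.
    refine Run.load (Run.const (Run.cons (Q' := _) (Run.mono (Run.loop_variant (E := E)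
      (fun s' => ∃ v, v ≤ L + 1 ∧ s'.reg 12 = s1.reg 12 + v ∧ s'.reg 14 = E.encG (A j ^ 2 ^ v) ∧
        (s'.reg 15 = 0 ↔ v ≠ 0 ∧ A j ^ 2 ^ v = 1) ∧ s'.reg 13 = j ∧
        (∀ r < 12, s'.reg r = s.reg r) ∧ s'.arr = s.arr)
      (fun s' => L + 1 + s1.reg 12 - s'.reg 12) 6 ?_ ?_) ?_ (fun _ h => h)) ?_))
    · rintro s2 ⟨v, hv, k12, k14, k15, k13, kr, ka⟩ ht
      have ht : 0 < s2.reg 15 := by simpa [kr 11, h11] using ht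
      have hvL : v < L + 1 := by
        rcases hv.lt_or_eq with h | h
        · exact h
        · exfalso
          apply ht.ne'
          rw [k15]
          refine ⟨by omega, ?_⟩
          rw [h, pow_succ, pow_mul, hL j hj, one_pow]
      refine Run.mulG _ _ k14 k14 (Run.add (Run.sub (Run.sub (Run.add (Run.nil ⟨⟨v + 1, hvL,
        ?_, ?_, ?_, ?_, ?_, ?_⟩, ?_⟩)))))
      · simp [k12, kr 7, h7, add_assoc]
      · simp [pow_succ, pow_mul]
      · have : A j ^ 2 ^ v * A j ^ 2 ^ v = A j ^ 2 ^ (v + 1) := by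
          simp [pow_succ, pow_mul]
        simp [this, kr 8, h8]
        rw [← E.encG.injective.eq_iff]
        omega
      · simp [k13]
      · intro r hr'
        simp (disch := omega) [kr]
      · simp [ka]
      · simp [k12, kr 7, h7]
        omega
    · refine ⟨0, by omega, ?_⟩
      simp [i13, ha, hA j hj]
      intro r hr'
      simp (disch := omega) [hr]
    · simp
    · rintro s2 ⟨⟨v, hv, k12, k14, k15, k13, kr, ka⟩, ht⟩
      have ht : s2.reg 15 = 0 := by simpa [kr 11, h11] using ht
      refine Run.add (Run.nil ⟨?_, ?_, ?_, ?_, ?_⟩)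
      · simp [k13, kr 7, h7]
      · simp [k12]
        rw [add_mul]
        omega
      · intro i hij
        simp [k12]
        rcases Nat.lt_succ_iff_lt_or_eq.1 hij with h | rfl
        · rw [pow_add, pow_mul, hi i h, one_pow]
        · rw [pow_add, mul_comm, pow_mul, (k15.1 ht).2, one_pow]
      · intro r hr'
        simp (disch := omega) [kr]
      · simp [ka]
  · refine ⟨by simp, by simp [h12], by simp, ?_, by simp⟩
    intro r hr'
    simp (disch := omega)
  · rintro s' ⟨i13, i12, hi, hr, ha⟩
    exact Run.nil ⟨_, rfl, i12, hi, hr, ha⟩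

/-! ### Meeting in the middle -/

theorem iteratedSquare_run {s : RState} {a : G} {t : ℕ} (h7 : s.reg 7 = 1) (h11 : s.reg 11 = 0)
    (h12 : s.reg 12 = t) (h15 : s.reg 15 = E.encG a) :
    Run E iteratedSquare s (4 * t + 4) (fun s' => s'.reg 17 = E.encG (a ^ 2 ^ t) ∧
      (∀ r, r ≠ 17 → r ≠ 20 → s'.reg r = s.reg r) ∧ s'.arr = s.arr) := by
  refine Run.le (T := 1 + (1 + (t * (3 + 1) + 1 + 1))) ?_ (by omega)
  refine Run.copy (Run.copy (Run.cons (Run.loop_count_const (fun j s' =>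
    s'.reg 17 = E.encG (a ^ 2 ^ j) ∧ s'.reg 20 = t - j ∧
      (∀ r, r ≠ 17 → r ≠ 20 → s'.reg r = s.reg r) ∧ s'.arr = s.arr) 3 t ?_ ?_ ?_) ?_))
  · rintro j s1 hj ⟨i17, i20, hr, ha⟩
    simp [i20, hr, h11]
  · rintro j s1 hj ⟨i17, i20, hr, ha⟩
    refine Run.mulG _ _ i17 i17 (Run.sub (Run.nil ⟨?_, ?_, ?_, ?_⟩))
    · simp [pow_succ, pow_mul]
    · simp [i20, hr, h7]
      omega
    · intro r hr1 hr2
      simp [hr1, hr2, hr]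
    · simp [ha]
  · refine ⟨by simp [h15], by simp [h12], ?_, by simp⟩
    intro r hr1 hr2
    simp [hr1, hr2]
  · rintro s1 ⟨i17, i20, hr, ha⟩
    exact Run.nil ⟨i17, hr, ha⟩

/-- The numbers `nc`, `nb`, `nk` are the names of `b ^ 2 ^ t`, `b` and `k` for some `b` in `G` with
`b ^ 2 ^ (t + 1) = 1` and some `k` in `H` such that `(b, k δ)` lies in the subgroup `S`. -/
def IsEntry (E : GroupAccess G H) (S : Subgroup (G × H)) (t : ℕ) (δ : H) (nc nb nk : ℕ) : Prop :=
  ∃ (b : G) (k : H), nc = E.encG (b ^ 2 ^ t) ∧ nb = E.encG b ∧ nk = E.encH k ∧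
    b ^ 2 ^ (t + 1) = 1 ∧ (b, k * δ) ∈ S

open Classical in
/-- The pairs with a nontrivial `2 ^ t`-th power of the first component are listed and squared; the
others are left alone. -/
theorem collect_run {s : RState} {S : Subgroup (G × H)} {X : ℕ → G} {Y : ℕ → H} {m t : ℕ}
    (h0 : s.reg 0 = m) (h7 : s.reg 7 = 1) (h8 : s.reg 8 = E.encG 1) (h11 : s.reg 11 = 0)
    (h12 : s.reg 12 = t) (hX : ∀ i < m, s.arr 0 i = E.encG (X i))
    (hY : ∀ i < m, s.arr 1 i = E.encH (Y i)) (hS : ∀ i < m, (X i, Y i) ∈ S)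
    (ht : ∀ i < m, X i ^ 2 ^ (t + 1) = 1) :
    Run E collect s (m * (4 * t + 20) + 4) (fun s' => ∃ r, s'.reg 14 = r ∧
      r = ((Finset.range m).filter fun i => X i ^ 2 ^ t ≠ 1).card ∧
      (∀ i < m, s'.arr 0 i = E.encG (if X i ^ 2 ^ t = 1 then X i else X i * X i)) ∧
      (∀ i < m, s'.arr 1 i = E.encH (if X i ^ 2 ^ t = 1 then Y i else Y i * Y i)) ∧
      (∀ ρ < r, IsEntry E S t 1 (s'.arr 6 ρ) (s'.arr 7 ρ) (s'.arr 8 ρ)) ∧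
      (∀ i < m, X i ^ 2 ^ t = 1 ∨ ∃ ρ < r, s'.arr 6 ρ = E.encG (X i ^ 2 ^ t)) ∧
      (∀ i, m ≤ i → s'.arr 0 i = s.arr 0 i ∧ s'.arr 1 i = s.arr 1 i) ∧
      (∀ r < 13, s'.reg r = s.reg r) ∧ ∀ A, 2 ≤ A → A < 6 → s'.arr A = s.arr A) := by
  refine Run.le (T := 1 + (1 + (m * (4 * t + 19 + 1) + 1 + 1))) ?_ (le_of_eq (by ring))
  refine Run.const (Run.const (Run.cons (Run.loop_count_const (fun j s' =>
      s'.reg 13 = j ∧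
      s'.reg 14 = ((Finset.range j).filter fun i => X i ^ 2 ^ t ≠ 1).card ∧
      (∀ i < m, s'.arr 0 i =
        E.encG (if j ≤ i then X i else if X i ^ 2 ^ t = 1 then X i else X i * X i)) ∧
      (∀ i < m, s'.arr 1 i =
        E.encH (if j ≤ i then Y i else if X i ^ 2 ^ t = 1 then Y i else Y i * Y i)) ∧
      (∀ ρ < s'.reg 14, IsEntry E S t 1 (s'.arr 6 ρ) (s'.arr 7 ρ) (s'.arr 8 ρ)) ∧
      (∀ i < j, X i ^ 2 ^ t = 1 ∨ ∃ ρ < s'.reg 14, s'.arr 6 ρ = E.encG (X i ^ 2 ^ t)) ∧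
      (∀ i, m ≤ i → s'.arr 0 i = s.arr 0 i ∧ s'.arr 1 i = s.arr 1 i) ∧
      (∀ r < 13, s'.reg r = s.reg r) ∧ ∀ A, 2 ≤ A → A < 6 → s'.arr A = s.arr A)
      (4 * t + 19) m ?_ ?_ ?_) ?_))
  · rintro j s1 hj ⟨i13, -, -, -, -, -, -, hr, -⟩
    simp [i13, hr 0, h0]
  · rintro j s1 hj ⟨i13, i14, i0, i1, ie, ic, io, hr, ha⟩
    refine Run.le (T := 1 + (1 + ((4 * t + 4) + ((9 + 1) + (1 + 1))))) ?_ (by omega)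
    refine Run.load (Run.load (Run.cons (iteratedSquare_run (a := X j) (t := t) ?_ ?_ ?_ ?_) ?_))
    · simp [hr 7, h7]
    · simp [hr 11, h11]
    · simp [hr 12, h12]
    · simp [i13, i0 j hj]
    rintro s2 ⟨j17, jr, ja⟩
    have e15 : s2.reg 15 = E.encG (X j) := by simp [jr, i13, i0 j hj]
    have e16 : s2.reg 16 = E.encH (Y j) := by simp [jr, i13, i1 j hj]
    have e13 : s2.reg 13 = j := by simp [jr, i13]
    have e14 : s2.reg 14 = s1.reg 14 := by simp [jr]
    have e8 : s2.reg 8 = E.encG 1 := by simp [jr, hr, h8]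
    have e7 : s2.reg 7 = 1 := by simp [jr, hr, h7]
    have er : ∀ r < 13, s2.reg r = s.reg r := by
      intro r hr'
      simp (disch := omega) [jr, hr]
    simp only [RState.arr_setReg] at ja
    refine Run.cons (Q' := fun s' => s'.reg 13 = j ∧ s'.reg 7 = 1 ∧
      s'.reg 14 = ((Finset.range (j + 1)).filter fun i => X i ^ 2 ^ t ≠ 1).card ∧
      (∀ i < m, s'.arr 0 i =
        E.encG (if j + 1 ≤ i then X i else if X i ^ 2 ^ t = 1 then X i else X i * X i)) ∧
      (∀ i < m, s'.arr 1 i =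
        E.encH (if j + 1 ≤ i then Y i else if X i ^ 2 ^ t = 1 then Y i else Y i * Y i)) ∧
      (∀ ρ < s'.reg 14, IsEntry E S t 1 (s'.arr 6 ρ) (s'.arr 7 ρ) (s'.arr 8 ρ)) ∧
      (∀ i < j + 1, X i ^ 2 ^ t = 1 ∨ ∃ ρ < s'.reg 14, s'.arr 6 ρ = E.encG (X i ^ 2 ^ t)) ∧
      (∀ i, m ≤ i → s'.arr 0 i = s.arr 0 i ∧ s'.arr 1 i = s.arr 1 i) ∧
      (∀ r < 13, s'.reg r = s.reg r) ∧ ∀ A, 2 ≤ A → A < 6 → s'.arr A = s.arr A)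
      (Run.ite (fun h => ?_) (fun h => ?_)) ?_
    · have h1 : X j ^ 2 ^ t = 1 := by simpa [j17, e8] using h
      refine (Run.nil ⟨e13, e7, ?_, ?_, ?_, ?_, ?_, ?_, er, ?_⟩).le (show 1 ≤ 9 by omega)
      · simp [e14, i14, Finset.range_add_one, Finset.filter_insert, h1]
      · intro i hi
        rw [ja, i0 i hi]
        rcases lt_trichotomy i j with h | rfl | h
        · simp [h.not_ge, show ¬ j + 1 ≤ i by omega]
        · simp [h1]
        · simp [h.le, show j + 1 ≤ i by omega]
      · intro i hi
        rw [ja, i1 i hi]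
        rcases lt_trichotomy i j with h | rfl | h
        · simp [h.not_ge, show ¬ j + 1 ≤ i by omega]
        · simp [h1]
        · simp [h.le, show j + 1 ≤ i by omega]
      · rw [ja, e14]
        exact ie
      · intro i hi
        rw [ja, e14]
        rcases Nat.lt_succ_iff_lt_or_eq.1 hi with h | rfl
        · exact ic i h
        · exact .inl h1
      · rw [ja]
        exact io
      · rw [ja]
        exact ha
    · have h1 : X j ^ 2 ^ t ≠ 1 := by simpa [j17, e8] using h
      refine Run.store (Run.store (Run.store (Run.mulG _ _ e15 e15 (Run.mulH (Y j) (Y j)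
        (by simp [e16]) (by simp [e16]) (Run.store (Run.store (Run.add (Run.nil
        ⟨by simp [e13], by simp [e7], ?_, ?_, ?_, ?_, ?_, ?_, ?_, ?_⟩))))))))
      · simp [e14, i14, e7, Finset.range_add_one, Finset.filter_insert, h1]
      · intro i hi
        simp [update_eq_ite, e13, ja, i0 i hi]
        rcases lt_trichotomy i j with h | rfl | h
        · simp [h.ne, h.not_ge]
          omega
        · simp [h1]
        · simp [h.ne', h.le]
          omega
      · intro i hi
        simp [update_eq_ite, e13, ja, i1 i hi]
        rcases lt_trichotomy i j with h | rfl | h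
        · simp [h.ne, h.not_ge]
          omega
        · simp [h1]
        · simp [h.ne', h.le]
          omega
      · intro ρ hρ
        simp [e14, e7] at hρ
        simp only [RState.arr_setReg, RState.arr_setArr_of_ne, RState.arr_setArr_self, ne_eq,
          update_eq_ite, RState.reg_setArr, ja, e14, j17, e15, e16, Nat.reduceEqDiff,
          OfNat.ofNat_ne_zero, OfNat.ofNat_ne_one, not_false_eq_true]
        rcases hρ.lt_or_eq with h | rfl
        · simpa [h.ne] using ie ρ h
        · simp only [if_true]
          exact ⟨X j, Y j, rfl, rfl, rfl, ht j hj, by simpa using hS j hj⟩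
      · intro i hi
        simp only [RState.arr_setReg, RState.arr_setArr_of_ne, RState.arr_setArr_self, ne_eq,
          update_eq_ite, RState.reg_setArr, ja, e14, j17, e15, e16, e7, Nat.reduceEqDiff,
          OfNat.ofNat_ne_zero, OfNat.ofNat_ne_one, not_false_eq_true, RState.reg_setReg_self,
          RState.reg_setReg_of_ne]
        rcases Nat.lt_succ_iff_lt_or_eq.1 hi with h | rfl
        · rcases ic i h with h2 | ⟨ρ, h2, h3⟩
          · exact .inl h2
          · exact .inr ⟨ρ, by omega, by simp [h2.ne, h3]⟩
        · exact .inr ⟨s1.reg 14, by simp, by simp⟩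
      · intro i hi
        simp [e13, ja, show i ≠ j by omega, io i hi]
      · intro r hr'
        simp (disch := omega) [er]
      · intro A hA hA'
        simp (disch := omega) [ja, ha]
    · rintro s3 ⟨k13, k7, k14, k0, k1, ke, kc, ko, kr, ka⟩
      refine Run.add (Run.nil ⟨by simp [k13, k7], by simp [k14], by simpa using k0,
        by simpa using k1, by simpa using ke, by simpa using kc, by simpa using ko, ?_,
        by simpa using ka⟩)
      intro r hr'
      simp (disch := omega) [kr]
  · refine ⟨by simp, by simp, by simpa using hX, by simpa using hY, by simp, by simp, by simp,
      ?_, by simp⟩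
    intro r hr'
    simp (disch := omega)
  · rintro s' ⟨i13, i14, i0, i1, ie, ic, io, hr, ha⟩
    refine Run.nil ⟨_, rfl, i14, fun i hi => ?_, fun i hi => ?_, ie, ic, io, hr, ha⟩
    · rw [i0 i hi, if_neg (by omega)]
    · rw [i1 i hi, if_neg (by omega)]

theorem IsEntry.mul {S : Subgroup (G × H)} {t : ℕ} {δ δ' : H} {c b c' b' : G} {k k' : H}
    {nc nb nk nc' nb' nk' : ℕ} (h : IsEntry E S t δ nc nb nk) (h' : IsEntry E S t δ' nc' nb' nk')
    (hc : nc = E.encG c) (hb : nb = E.encG b) (hk : nk = E.encH k)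
    (hc' : nc' = E.encG c') (hb' : nb' = E.encG b') (hk' : nk' = E.encH k') :
    IsEntry E S t (δ * δ') (E.encG (c * c')) (E.encG (b * b')) (E.encH (k * k')) := by
  obtain ⟨b₁, k₁, h1, h2, h3, h4, h5⟩ := h
  obtain ⟨b₂, k₂, i1, i2, i3, i4, i5⟩ := h'
  obtain rfl : b = b₁ := E.encG.injective (hb.symm.trans h2)
  obtain rfl : b' = b₂ := E.encG.injective (hb'.symm.trans i2)
  obtain rfl : c = b ^ 2 ^ t := E.encG.injective (hc.symm.trans h1)
  obtain rfl : c' = b' ^ 2 ^ t := E.encG.injective (hc'.symm.trans i1)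
  obtain rfl : k = k₁ := E.encH.injective (hk.symm.trans h3)
  obtain rfl : k' = k₂ := E.encH.injective (hk'.symm.trans i3)
  refine ⟨b * b', k * k', by rw [mul_pow], rfl, rfl, by rw [mul_pow, h4, i4, one_mul], ?_⟩
  have := S.mul_mem h5 i5
  rwa [Prod.mk_mul_mk, mul_mul_mul_comm] at this

/-- The set of the elements whose names are in the cells `i, …, j - 1` of an array. -/
def cells (enc : G ↪ ℕ) (f : ℕ → ℕ) (i j : ℕ) : Set G :=
  {c | ∃ ρ, i ≤ ρ ∧ ρ < j ∧ f ρ = enc c}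

/-- An involution that is added to a segment at most doubles the generated group. -/
theorem mem_closure_cells_succ {enc : G ↪ ℕ} {f : ℕ → ℕ} {i j : ℕ} {c v : G} (hc : f j = enc c)
    (hcc : c * c = 1) (hv : v ∈ Subgroup.closure (cells enc f i (j + 1))) :
    v ∈ Subgroup.closure (cells enc f i j) ∨ v * c ∈ Subgroup.closure (cells enc f i j) := by
  induction hv using Subgroup.closure_induction with
  | mem x hx =>
    obtain ⟨ρ, h1, h2, h3⟩ := hx
    rcases Nat.lt_succ_iff_lt_or_eq.1 h2 with h | rfl
    · exact .inl (Subgroup.subset_closure ⟨ρ, h1, h, h3⟩)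
    · obtain rfl : x = c := enc.injective (h3.symm.trans hc)
      exact .inr (by rw [hcc]; exact one_mem _)
  | one => exact .inl (one_mem _)
  | mul x y _ _ hx hy =>
    rcases hx with hx | hx <;> rcases hy with hy | hy
    · exact .inl (mul_mem hx hy)
    · exact .inr (by rw [mul_assoc]; exact mul_mem hx hy)
    · exact .inr (by rw [mul_right_comm]; exact mul_mem hx hy)
    · refine .inl ?_
      have := mul_mem hx hy
      rwa [mul_mul_mul_comm, hcc, mul_one] at this
  | inv x _ hx =>
    rcases hx with hx | hx
    · exact .inl (inv_mem hx)
    · refine .inr ?_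
      have := inv_mem hx
      rwa [mul_inv, inv_eq_of_mul_eq_one_right hcc] at this

/-- Extending the table by one element doubles it. -/
theorem buildTable_inner_run {s : RState} {S : Subgroup (G × H)} {δ : H} {t n w₀ : ℕ} {c b : G}
    {k : H} (h7 : s.reg 7 = 1) (h19 : s.reg 23 = w₀) (h20 : s.reg 20 = w₀ + n)
    (h27 : s.reg 27 = w₀ + n) (h24 : s.reg 24 = E.encG c) (h25 : s.reg 25 = E.encG b)
    (h26 : s.reg 26 = E.encH k) (he : IsEntry E S t 1 (E.encG c) (E.encG b) (E.encH k))
    (hT : ∀ j < n, IsEntry E S t δ (s.arr 9 (w₀ + j)) (s.arr 10 (w₀ + j)) (s.arr 11 (w₀ + j))) :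
    Run E (.loop (.lt 23 27) (block [
      .load 28 9 23, .mulG 28 28 24, .store 9 20 28,
      .load 28 10 23, .mulG 28 28 25, .store 10 20 28,
      .load 28 11 23, .mulH 28 28 26, .store 11 20 28,
      .add 20 20 7, .add 23 23 7])) s (13 * n + 1) (fun s' => s'.reg 20 = w₀ + (n + n) ∧
      (∀ j < n, IsEntry E S t δ (s'.arr 9 (w₀ + n + j)) (s'.arr 10 (w₀ + n + j))
        (s'.arr 11 (w₀ + n + j))) ∧
      (∀ j < n, ∀ d, s.arr 9 (w₀ + j) = E.encG d → s'.arr 9 (w₀ + n + j) = E.encG (d * c)) ∧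
      (∀ A, ∀ j < w₀ + n, s'.arr A j = s.arr A j) ∧
      (∀ A, A < 9 ∨ 11 < A → s'.arr A = s.arr A) ∧
      (∀ r < 23, r ≠ 20 → s'.reg r = s.reg r)) := by
  refine Run.mono (Run.loop_count_const (fun i s' => s'.reg 23 = w₀ + i ∧
      s'.reg 20 = w₀ + n + i ∧
      (∀ j < i, IsEntry E S t δ (s'.arr 9 (w₀ + n + j)) (s'.arr 10 (w₀ + n + j))
        (s'.arr 11 (w₀ + n + j))) ∧
      (∀ j < i, ∀ d, s.arr 9 (w₀ + j) = E.encG d → s'.arr 9 (w₀ + n + j) = E.encG (d * c)) ∧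
      (∀ A, ∀ j < w₀ + n, s'.arr A j = s.arr A j) ∧
      (∀ A, A < 9 ∨ 11 < A → s'.arr A = s.arr A) ∧
      (∀ r < 23, r ≠ 20 → s'.reg r = s.reg r) ∧ (∀ r, 24 ≤ r → r < 28 → s'.reg r = s.reg r))
      12 n ?_ ?_ ?_) (by omega) ?_
  · rintro i s1 hi ⟨i23, i20, ie, ic, io, ia, ir, ir'⟩
    simp [i23, ir' 27, h27]
  · rintro i s1 hi ⟨i23, i20, ie, ic, io, ia, ir, ir'⟩
    have hTi := hT i hi
    obtain ⟨b₁, k₁, e1, e2, e3, -, -⟩ := hT i hi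
    have e1' : s1.arr 9 (w₀ + i) = E.encG (b₁ ^ 2 ^ t) := by rw [io 9 _ (by omega), e1]
    have e2' : s1.arr 10 (w₀ + i) = E.encG b₁ := by rw [io 10 _ (by omega), e2]
    have e3' : s1.arr 11 (w₀ + i) = E.encH k₁ := by rw [io 11 _ (by omega), e3]
    have f7 : s1.reg 7 = 1 := by rw [ir 7 (by omega) (by omega), h7]
    have f24 : s1.reg 24 = E.encG c := by rw [ir' 24 (by omega) (by omega), h24]
    have f25 : s1.reg 25 = E.encG b := by rw [ir' 25 (by omega) (by omega), h25]
    have f26 : s1.reg 26 = E.encH k := by rw [ir' 26 (by omega) (by omega), h26]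
    refine Run.load (Run.mulG (b₁ ^ 2 ^ t) c (by simp [i23, e1']) (by simp [f24])
      (Run.store (Run.load (Run.mulG b₁ b (by simp [i23, e2']) (by simp [f25])
      (Run.store (Run.load (Run.mulH k₁ k (by simp [i23, e3']) (by simp [f26])
      (Run.store (Run.add (Run.add (Run.nil ⟨by simp [i23, f7, add_assoc],
        by simp [i20, f7, add_assoc], ?_, ?_, ?_, ?_, ?_, ?_⟩)))))))))))
    · intro j hj
      rcases Nat.lt_succ_iff_lt_or_eq.1 hj with h | rfl
      · simpa [i20, h.ne] using ie j h
      · have := hTi.mul he e1 e2 e3 rfl rfl rfl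
        simpa [i20] using this
    · intro j hj d hd
      rcases Nat.lt_succ_iff_lt_or_eq.1 hj with h | rfl
      · simpa [i20, h.ne] using ic j h d hd
      · obtain rfl : d = b₁ ^ 2 ^ t := E.encG.injective (hd.symm.trans e1)
        simp [i20]
    · intro A j hj
      have hji : j ≠ w₀ + n + i := by omega
      by_cases h9 : A = 9
      · subst h9; simp [i20, hji, io 9 j hj]
      by_cases h10 : A = 10
      · subst h10; simp [i20, hji, io 10 j hj]
      by_cases h11 : A = 11
      · subst h11; simp [i20, hji, io 11 j hj]
      simp [h9, h10, h11, io A j hj]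
    · intro A hA
      simp (disch := omega) [ia A hA]
    · intro r hr hr'
      simp (disch := omega) [ir]
    · intro r hr hr'
      simp (disch := omega) [ir']
  · exact ⟨by simp [h19], by simp [h20], by simp, by simp, fun _ _ _ => rfl, fun _ _ => rfl,
      fun _ _ _ => rfl, fun _ _ _ => rfl⟩
  · rintro s' ⟨i23, i20, ie, ic, io, ia, ir, ir'⟩
    exact ⟨by rw [i20, add_assoc], ie, ic, io, ia, ir⟩

theorem buildTable_cost (n : ℕ) :
    ∑ d ∈ Finset.range n, (13 * 2 ^ d + 8 + 1) + 22 ≤ 22 * 2 ^ n := by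
  induction n with
  | zero => simp
  | succ n ih =>
    rw [Finset.sum_range_succ, pow_succ]
    have := Nat.one_le_two_pow (n := n)
    omega

/-- The table of all products of a triple with subproducts of a segment of the collected triples.
Its first column contains all products of `c` with elements of the subgroup generated by the
first components of the segment. -/
theorem buildTable_run {s : RState} {S : Subgroup (G × H)} {δ : H} {t n i₀ w₀ : ℕ} {c : G}
    (h7 : s.reg 7 = 1) (h17 : s.reg 17 = E.encG c)
    (he : IsEntry E S t δ (s.reg 17) (s.reg 15) (s.reg 16)) (h18 : s.reg 18 = i₀)
    (h21 : s.reg 21 = i₀ + n) (h20 : s.reg 20 = w₀)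
    (hL : ∀ ρ < i₀ + n, IsEntry E S t 1 (s.arr 6 ρ) (s.arr 7 ρ) (s.arr 8 ρ)) :
    Run E buildTable s (22 * 2 ^ n + 8) (fun s' => s'.reg 20 = w₀ + 2 ^ n ∧ s'.reg 18 = i₀ + n ∧
      (∀ j < 2 ^ n, IsEntry E S t δ (s'.arr 9 (w₀ + j)) (s'.arr 10 (w₀ + j))
        (s'.arr 11 (w₀ + j))) ∧
      (∀ v ∈ Subgroup.closure (cells E.encG (s.arr 6) i₀ (i₀ + n)),
        ∃ j < 2 ^ n, s'.arr 9 (w₀ + j) = E.encG (c * v)) ∧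
      (∀ A, ∀ j < w₀, s'.arr A j = s.arr A j) ∧
      (∀ A, A < 9 ∨ 11 < A → s'.arr A = s.arr A) ∧
      (∀ r < 23, r ≠ 18 → r ≠ 19 → r ≠ 20 → s'.reg r = s.reg r)) := by
  refine Run.le (T := 1 + (1 + (1 + (1 + (1 +
    (∑ d ∈ Finset.range n, (13 * 2 ^ d + 8 + 1) + 1 + 1)))))) ?_ (by
      have := buildTable_cost n
      omega)
  refine Run.copy (Run.store (Run.store (Run.store (Run.add (Run.cons (Run.loop_count (fun d s' =>
      s'.reg 18 = i₀ + d ∧ s'.reg 19 = w₀ ∧ s'.reg 20 = w₀ + 2 ^ d ∧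
      (∀ j < 2 ^ d, IsEntry E S t δ (s'.arr 9 (w₀ + j)) (s'.arr 10 (w₀ + j))
        (s'.arr 11 (w₀ + j))) ∧
      (∀ v ∈ Subgroup.closure (cells E.encG (s.arr 6) i₀ (i₀ + d)),
        ∃ j < 2 ^ d, s'.arr 9 (w₀ + j) = E.encG (c * v)) ∧
      (∀ A, ∀ j < w₀, s'.arr A j = s.arr A j) ∧
      (∀ A, A < 9 ∨ 11 < A → s'.arr A = s.arr A) ∧
      (∀ r < 23, r ≠ 18 → r ≠ 19 → r ≠ 20 → s'.reg r = s.reg r))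
      (fun d => 13 * 2 ^ d + 8) n ?_ ?_ ?_) ?_)))))
  · rintro d s1 hd ⟨i18, -, -, -, -, -, -, ir⟩
    simp [i18, ir 21, h21]
  · rintro d s1 hd ⟨i18, i19, i20, ie, ic, io, ia, ir⟩
    have hLd := hL (i₀ + d) (by omega)
    obtain ⟨b, k, e1, e2, e3, e4, -⟩ := hL (i₀ + d) (by omega)
    have f6 : s1.arr 6 = s.arr 6 := ia 6 (by omega)
    have f7 : s1.arr 7 = s.arr 7 := ia 7 (by omega)
    have f8 : s1.arr 8 = s.arr 8 := ia 8 (by omega)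
    have g7 : s1.reg 7 = 1 := by rw [ir 7 (by omega) (by omega) (by omega) (by omega), h7]
    have hcc : b ^ 2 ^ t * b ^ 2 ^ t = 1 := by rw [← pow_two, ← pow_mul, ← pow_succ, e4]
    refine Run.le (T := 1 + (1 + (1 + (1 + (1 + ((13 * 2 ^ d + 1) + (1 + 1))))))) ?_ (by omega)
    refine Run.load (Run.load (Run.load (Run.copy (Run.copy (Run.cons
      (buildTable_inner_run (S := S) (t := t) (δ := δ) (n := 2 ^ d) (w₀ := w₀) (c := b ^ 2 ^ t)
        (b := b) (k := k) ?_ ?_ ?_ ?_ ?_ ?_ ?_ ?_ ?_) ?_)))))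
    · simp [g7]
    · simp [i19]
    · simp [i20]
    · simp [i20]
    · simp [i18, f6, e1]
    · simp [i18, f7, e2]
    · simp [i18, f8, e3]
    · rwa [e1, e2, e3] at hLd
    · simpa using ie
    rintro s2 ⟨j20, je, jc, jo, ja, jr⟩
    simp only [RState.arr_setReg] at jc jo ja
    refine Run.add (Run.nil ⟨?_, ?_, ?_, ?_, ?_, ?_, ?_, ?_⟩)
    · simp [jr, i18, g7, add_assoc]
    · simp [jr, i19]
    · simp [j20, pow_succ, mul_two]
    · intro j hj
      simp only [RState.arr_setReg]
      rcases lt_or_ge j (2 ^ d) with h | h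
      · simpa only [jo _ _ (show w₀ + j < w₀ + 2 ^ d by omega)] using ie j h
      · have := je (j - 2 ^ d) (by rw [pow_succ] at hj; omega)
        rwa [show w₀ + 2 ^ d + (j - 2 ^ d) = w₀ + j by omega] at this
    · intro v hv
      simp only [RState.arr_setReg]
      rcases mem_closure_cells_succ e1 hcc hv with h | h
      · obtain ⟨j, hj, h'⟩ := ic v h
        exact ⟨j, by rw [pow_succ]; omega, by rw [jo _ _ (by omega), h']⟩
      · obtain ⟨j, hj, h'⟩ := ic _ h
        refine ⟨2 ^ d + j, by rw [pow_succ]; omega, ?_⟩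
        rw [← add_assoc, jc j hj _ h', mul_assoc, mul_assoc, hcc, mul_one]
    · intro A j hj
      simp only [RState.arr_setReg]
      rw [jo A j (Nat.lt_add_right _ hj), io A j hj]
    · intro A hA
      simp only [RState.arr_setReg]
      rw [ja A hA, ia A hA]
    · intro r h1 h2 h3 h4
      simp (disch := omega) [jr, ir]
  · refine ⟨by simp [h18], by simp [h20], by simp [h20, h7], ?_, ?_, ?_, ?_, ?_⟩
    · simpa [h20] using he
    · intro v hv
      have : cells E.encG (s.arr 6) i₀ (i₀ + 0) = ∅ := by
        ext x
        simp only [cells, Set.mem_ofPred_eq, Set.mem_empty_iff_false, iff_false]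
        rintro ⟨ρ, h1, h2, -⟩
        omega
      rw [this, Subgroup.closure_empty, Subgroup.mem_bot] at hv
      exact ⟨0, by simp, by simp [h20, h17, hv]⟩
    · intro A j hj
      have hne : j ≠ w₀ := by omega
      by_cases h9 : A = 9
      · subst h9; simp [h20, hne]
      by_cases h10 : A = 10
      · subst h10; simp [h20, hne]
      by_cases h11 : A = 11
      · subst h11; simp [h20, hne]
      simp [h9, h10, h11]
    · intro A hA
      simp (disch := omega)
    · intro r h1 h2 h3 h4
      simp (disch := omega)
  · rintro s' ⟨i18, i19, i20, ie, ic, io, ia, ir⟩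
    exact Run.nil ⟨i20, i18, ie, ic, io, ia, ir⟩

/-- Afterwards the record of an entry of the first table points to an equal entry, whatever the
array `12` held before. -/
theorem fillDirectory_run {s : RState} {n : ℕ} (h7 : s.reg 7 = 1) (h22 : s.reg 22 = n) :
    Run E fillDirectory s (5 * n + 3) (fun s' => s'.reg 23 = n ∧
      (∀ j < n, s'.arr 12 (s.arr 9 j) < n ∧ s.arr 9 (s'.arr 12 (s.arr 9 j)) = s.arr 9 j) ∧
      (∀ A, A ≠ 12 → s'.arr A = s.arr A) ∧ ∀ r < 23, s'.reg r = s.reg r) := by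
  refine Run.le (T := 1 + (n * (4 + 1) + 1 + 1)) ?_ (by omega)
  refine Run.const (Run.cons (Run.loop_count_const (fun i s' => s'.reg 23 = i ∧
      (∀ j < i, s'.arr 12 (s.arr 9 j) < i ∧ s.arr 9 (s'.arr 12 (s.arr 9 j)) = s.arr 9 j) ∧
      (∀ A, A ≠ 12 → s'.arr A = s.arr A) ∧ ∀ r < 23, s'.reg r = s.reg r) 4 n ?_ ?_ ?_) ?_)
  · rintro i s1 hi ⟨i23, -, -, ir⟩
    simp [i23, ir, h22]
  · rintro i s1 hi ⟨i23, id, ia, ir⟩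
    refine Run.load (Run.store (Run.add (Run.nil ⟨?_, ?_, ?_, ?_⟩)))
    · simp [i23, ir, h7]
    · intro j hj
      have h9 : s1.arr 9 = s.arr 9 := ia 9 (by omega)
      simp only [RState.arr_setReg, RState.arr_setArr_self, RState.reg_setReg_self,
        update_eq_ite, i23, h9, RState.reg_setReg_of_ne, ne_eq, Nat.reduceEqDiff,
        not_false_eq_true]
      split_ifs with h
      · exact ⟨by omega, h.symm⟩
      · have hji : j < i := by
          rcases Nat.lt_succ_iff_lt_or_eq.1 hj with h' | rfl
          · exact h'
          · exact absurd rfl h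
        exact ⟨(id j hji).1.trans (by omega), (id j hji).2⟩
    · intro A hA
      simp [hA, ia]
    · intro r hr
      simp (disch := omega) [ir]
  · refine ⟨by simp, by simp, by simp, ?_⟩
    intro r hr
    simp (disch := omega)
  · rintro s' h
    exact Run.nil h

/-- If some entry of the first table (in the cells below `n`) coincides in the first column with
some entry of the second table (in the next `l` cells), then a valid new ciphertext is found. Every
coincidence serves this purpose, so it does not matter that the last one found prevails. -/
theorem scanTable_run {s : RState} {S : Subgroup (G × H)} {δ : H} {t n l m : ℕ}
    (h0 : s.reg 0 = m) (h7 : s.reg 7 = 1) (h20 : s.reg 20 = n + l) (h22 : s.reg 22 = n)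
    (h23 : s.reg 23 = n)
    (hd : ∀ j < n, s.arr 12 (s.arr 9 j) < n ∧ s.arr 9 (s.arr 12 (s.arr 9 j)) = s.arr 9 j)
    (h1 : ∀ j < n, IsEntry E S t δ (s.arr 9 j) (s.arr 10 j) (s.arr 11 j))
    (h2 : ∀ j < l, IsEntry E S t 1 (s.arr 9 (n + j)) (s.arr 10 (n + j)) (s.arr 11 (n + j)))
    (hmatch : ∃ i < n, ∃ j < l, s.arr 9 i = s.arr 9 (n + j)) :
    Run E scanTable s (18 * l + 2) (fun s' =>
      (∃ y h, s'.arr 0 m = E.encG y ∧ s'.arr 1 m = E.encH h ∧ y ^ 2 ^ t = 1 ∧ (y, h * δ) ∈ S) ∧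
      (∀ i, i ≠ m → s'.arr 0 i = s.arr 0 i ∧ s'.arr 1 i = s.arr 1 i) ∧
      (∀ A, 2 ≤ A → s'.arr A = s.arr A) ∧ ∀ r < 23, s'.reg r = s.reg r) := by
  refine Run.le (T := l * (17 + 1) + 1 + 1) ?_ (by omega)
  refine Run.cons (Run.loop_count_const (fun j s' => s'.reg 23 = n + j ∧
      ((∃ y h, s'.arr 0 m = E.encG y ∧ s'.arr 1 m = E.encH h ∧ y ^ 2 ^ t = 1 ∧ (y, h * δ) ∈ S) ∨
        ∀ i < n, ∀ j' < j, s.arr 9 i ≠ s.arr 9 (n + j')) ∧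
      (∀ i, i ≠ m → s'.arr 0 i = s.arr 0 i ∧ s'.arr 1 i = s.arr 1 i) ∧
      (∀ A, 2 ≤ A → s'.arr A = s.arr A) ∧ ∀ r < 23, s'.reg r = s.reg r) 17 l ?_ ?_ ?_) ?_
  · rintro j s1 hj ⟨i23, -, -, -, ir⟩
    simp [i23, ir 20, h20]
  · rintro j s1 hj ⟨i23, ig, io, ia, ir⟩
    have f9 : s1.arr 9 = s.arr 9 := ia 9 (by omega)
    have f10 : s1.arr 10 = s.arr 10 := ia 10 (by omega)
    have f11 : s1.arr 11 = s.arr 11 := ia 11 (by omega)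
    have f12 : s1.arr 12 = s.arr 12 := ia 12 (by omega)
    have g0 : s1.reg 0 = m := by rw [ir 0 (by omega), h0]
    have g7 : s1.reg 7 = 1 := by rw [ir 7 (by omega), h7]
    have g22 : s1.reg 22 = n := by rw [ir 22 (by omega), h22]
    refine Run.le (T := 1 + (1 + (((1 + (9 + 1 + 1)) + 1) + (1 + 1)))) ?_ (by omega)
    refine Run.load (Run.load (Run.cons (Q' := fun s' => s'.reg 23 = n + j ∧
      ((∃ y h, s'.arr 0 m = E.encG y ∧ s'.arr 1 m = E.encH h ∧ y ^ 2 ^ t = 1 ∧ (y, h * δ) ∈ S) ∨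
        ∀ i < n, ∀ j' < j + 1, s.arr 9 i ≠ s.arr 9 (n + j')) ∧
      (∀ i, i ≠ m → s'.arr 0 i = s.arr 0 i ∧ s'.arr 1 i = s.arr 1 i) ∧
      (∀ A, 2 ≤ A → s'.arr A = s.arr A) ∧ ∀ r < 23, s'.reg r = s.reg r) ?_ ?_))
    · have hno : (∀ i < n, s.arr 9 i ≠ s.arr 9 (n + j)) →
          ((∃ y h, s1.arr 0 m = E.encG y ∧ s1.arr 1 m = E.encH h ∧ y ^ 2 ^ t = 1 ∧
            (y, h * δ) ∈ S) ∨ ∀ i < n, ∀ j' < j + 1, s.arr 9 i ≠ s.arr 9 (n + j')) := by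
        intro h
        refine ig.imp id fun h' i hi j' hj' => ?_
        rcases Nat.lt_succ_iff_lt_or_eq.1 hj' with h'' | rfl
        · exact h' i hi j' h''
        · exact h i hi
      refine Run.ite (fun h => ?_) (fun h => ?_)
      · have hlt : s.arr 12 (s.arr 9 (n + j)) < n := by
          simpa [f9, f12, i23, g22] using h
        refine Run.load (Run.cons (Run.ite (fun h => ?_) (fun h => ?_)) fun s' h' => Run.nil h')
        · have heq : s.arr 9 (s.arr 12 (s.arr 9 (n + j))) = s.arr 9 (n + j) := by
            simpa [f9, f12, i23] using h
          set i := s.arr 12 (s.arr 9 (n + j)) with hi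
          have k1 := h1 i hlt
          have k2 := h2 j hj
          obtain ⟨b₁, k₁, e1, e2, e3, e4, -⟩ := h1 i hlt
          obtain ⟨b₂, k₂, d1, d2, d3, -, -⟩ := h2 j hj
          refine Run.load (Run.load (Run.mulG b₁ b₂ ?_ ?_ (Run.store (Run.load (Run.load
            (Run.mulH k₁ k₂ ?_ ?_ (Run.store (Run.nil ⟨?_, .inl ⟨b₁ * b₂, k₁ * k₂, ?_, ?_, ?_, ?_⟩,
              ?_, ?_, ?_⟩))))))))
          · simp [i23, f9, f10, f12, ← hi, e2]
          · simp [i23, f10, d2]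
          · simp [i23, f9, f11, f12, ← hi, e3]
          · simp [i23, f11, d3]
          · simp [i23]
          · simp [g0]
          · simp [g0]
          · have : b₁ ^ 2 ^ t = b₂ ^ 2 ^ t := E.encG.injective (by rw [← e1, ← d1, heq])
            rw [mul_pow, ← this, ← pow_two, ← pow_mul, ← pow_succ, e4]
          · obtain ⟨b, k, -, q2, q3, -, q5⟩ := k1.mul k2 e1 e2 e3 d1 d2 d3
            rw [E.encG.injective q2, E.encH.injective q3]
            simpa using q5
          · intro i' hi'
            simp [g0, hi', io i' hi']
          · intro A hA
            simp (disch := omega) [ia A hA]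
          · intro r hr
            simp (disch := omega) [ir]
        · have hne : s.arr 9 (s.arr 12 (s.arr 9 (n + j))) ≠ s.arr 9 (n + j) := by
            simpa [f9, f12, i23] using h
          refine (Run.nil ⟨by simp [i23], ?_, by simpa using io, by simpa using ia, ?_⟩).le
            (show 1 ≤ 9 by omega)
          · simp only [RState.arr_setReg]
            exact hno fun i hi h' => hne (by rw [← h']; exact (hd i hi).2)
          · intro r hr
            simp (disch := omega) [ir]
      · have hge : ¬ s.arr 12 (s.arr 9 (n + j)) < n := by
          simpa [f9, f12, i23, g22] using h
        refine (Run.nil ⟨by simp [i23], ?_, by simpa using io, by simpa using ia, ?_⟩).le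
          (show 1 ≤ 12 by omega)
        · simp only [RState.arr_setReg]
          exact hno fun i hi h' => hge (by rw [← h']; exact (hd i hi).1)
        · intro r hr
          simp (disch := omega) [ir]
    · rintro s2 ⟨j23, jg, jo, ja, jr⟩
      refine Run.add (Run.nil ⟨by simp [j23, jr 7, h7, add_assoc], by simpa using jg,
        by simpa using jo, by simpa using ja, ?_⟩)
      intro r hr
      simp (disch := omega) [jr]
  · exact ⟨by simp [h23], .inr (by simp), fun _ _ => ⟨rfl, rfl⟩, fun _ _ => rfl, fun _ _ => rfl⟩
  · rintro s' ⟨-, ig, io, ia, ir⟩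
    refine Run.nil ⟨?_, io, ia, ir⟩
    rcases ig with h | h
    · exact h
    · obtain ⟨i, hi, j, hj, hij⟩ := hmatch
      exact absurd hij (h i hi j hj)

/-! ### Discrete logarithms, one binary digit at a time -/

/-- The pairs `(x i, κ i)` for `i < m` generate the subgroup `S` of `G × H`, the `x i` are
independent, and `x i` has order `2 ^ e i`. -/
structure KeyData (S : Subgroup (G × H)) (m : ℕ) (x : ℕ → G) (κ : ℕ → H) (e : ℕ → ℕ) : Prop where
  mem : ∀ i < m, (x i, κ i) ∈ S
  orderOf_eq : ∀ i < m, orderOf (x i) = 2 ^ e i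
  eq_one : ∀ n : ℕ → ℕ, ∏ i ∈ Finset.range m, x i ^ n i = 1 → ∀ i < m, x i ^ n i = 1
  exists_eq : ∀ p ∈ S, ∃ n : ℕ → ℕ,
    p = (∏ i ∈ Finset.range m, x i ^ n i, ∏ i ∈ Finset.range m, κ i ^ n i)

namespace KeyData

variable {S : Subgroup (G × H)} {m : ℕ} {x : ℕ → G} {κ : ℕ → H} {e : ℕ → ℕ}

theorem pow_eq_one_iff (D : KeyData S m x κ e) {i : ℕ} (hi : i < m) (t : ℕ) :
    (x i ^ 2 ^ (e i - (t + 1))) ^ 2 ^ t = 1 ↔ e i ≤ t := by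
  rw [← pow_mul, ← pow_add, ← orderOf_dvd_iff_pow_eq_one, D.orderOf_eq i hi,
    Nat.pow_dvd_pow_iff_le_right (by omega)]
  omega

theorem pow_two_pow_eq_one (D : KeyData S m x κ e) {i : ℕ} (hi : i < m) (t : ℕ) :
    (x i ^ 2 ^ (e i - t)) ^ 2 ^ t = 1 := by
  rw [← pow_mul, ← pow_add, ← orderOf_dvd_iff_pow_eq_one, D.orderOf_eq i hi,
    Nat.pow_dvd_pow_iff_le_right (by omega)]
  omega

/-- The key step of the discrete logarithm: if `y ^ 2 ^ (t + 1) = 1`, then by independence of the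
`x i` the involution `y ^ 2 ^ t` is a product of involutions in the cyclic groups `⟨x i⟩`. -/
theorem pow_two_pow_mem (D : KeyData S m x κ e) {y : G} {h : H} {t : ℕ} (hy : (y, h) ∈ S)
    (hyt : y ^ 2 ^ (t + 1) = 1) {V : Subgroup G}
    (hV : ∀ i < m, (x i ^ 2 ^ (e i - (t + 1))) ^ 2 ^ t ∈ V) : y ^ 2 ^ t ∈ V := by
  obtain ⟨n, hn⟩ := D.exists_eq _ hy
  obtain rfl : y = _ := congrArg Prod.fst hn
  simp only [← Finset.prod_pow, ← pow_mul] at hyt ⊢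
  refine Subgroup.prod_mem _ fun i hi => ?_
  have hi := Finset.mem_range.1 hi
  rcases le_or_gt (e i) t with h1 | h1
  · have : x i ^ 2 ^ t = 1 := by
      rw [← orderOf_dvd_iff_pow_eq_one, D.orderOf_eq i hi]
      exact pow_dvd_pow 2 h1
    rw [mul_comm, pow_mul, this, one_pow]
    exact V.one_mem
  · have h2 := D.eq_one _ hyt i hi
    rw [← orderOf_dvd_iff_pow_eq_one, D.orderOf_eq i hi] at h2
    obtain ⟨q, hq⟩ : 2 ^ (e i - (t + 1)) ∣ n i := by
      refine Nat.dvd_of_mul_dvd_mul_right (k := 2 ^ (t + 1)) (by positivity) ?_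
      rwa [← pow_add, Nat.sub_add_cancel h1]
    have := V.pow_mem (hV i hi) q
    rwa [← pow_mul, ← pow_mul, mul_comm (2 ^ t) q, ← mul_assoc, ← hq] at this

end KeyData

/-- State of the computation after the digits from `u` on have been removed from the exponents of
the first component of the ciphertext. The ciphertext is stored behind the public elements. -/
def LevelInv (E : GroupAccess G H) (S : Subgroup (G × H)) (m : ℕ) (x : ℕ → G) (κ : ℕ → H)
    (e : ℕ → ℕ) (δ : H) (s₀ : RState) (u : ℕ) (s : RState) : Prop :=
  s.reg 12 = u ∧ (∀ r < 12, s.reg r = s₀.reg r) ∧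
  (∀ A, 2 ≤ A → A < 6 → s.arr A = s₀.arr A) ∧
  (∀ i < m, s.arr 0 i = E.encG (x i ^ 2 ^ (e i - u)) ∧
    s.arr 1 i = E.encH (κ i ^ 2 ^ (e i - u))) ∧
  ∃ y h, s.arr 0 m = E.encG y ∧ s.arr 1 m = E.encH h ∧ y ^ 2 ^ u = 1 ∧ (y, h * δ) ∈ S

/-- One level costs a polynomial amount plus `O(2 ^ (r / 2))`, where `r` is the number of the
generators whose order exceeds `2 ^ t`. -/
theorem level_run {S : Subgroup (G × H)} {m : ℕ} {x : ℕ → G} {κ : ℕ → H} {e : ℕ → ℕ}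
    {δ : H} {s₀ s : RState} {t : ℕ} (D : KeyData S m x κ e) (h0 : s₀.reg 0 = m)
    (h7 : s₀.reg 7 = 1) (h8 : s₀.reg 8 = E.encG 1) (h9 : s₀.reg 9 = E.encH 1)
    (h11 : s₀.reg 11 = 0) (hs : LevelInv E S m x κ e δ s₀ (t + 1) s) :
    Run E level s ((m + 1) * (4 * t + 41) +
        67 * 2 ^ ((((Finset.range m).filter fun i => t < e i).card + 1) / 2))
      (LevelInv E S m x κ e δ s₀ t) := by
  obtain ⟨h12, hr, ha, hk, y, h, hy, hh, hyt, hS⟩ := hs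
  set r := ((Finset.range m).filter fun i => t < e i).card with hrdef
  set X : ℕ → G := fun i => x i ^ 2 ^ (e i - (t + 1)) with hX
  set Y : ℕ → H := fun i => κ i ^ 2 ^ (e i - (t + 1)) with hY
  have hcost : 2 ^ (r / 2) ≤ 2 ^ ((r + 1) / 2) := Nat.pow_le_pow_right (by omega) (by omega)
  refine Run.le (T := 1 + ((m * (4 * t + 20) + 4) + (1 + (1 + ((4 * t + 4) + (1 + (1 + (1 +
    ((22 * 2 ^ (r / 2) + 8) + (1 + (1 + (1 + (1 + (1 + ((22 * 2 ^ ((r + 1) / 2) + 8) +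
    ((5 * 2 ^ (r / 2) + 3) + ((18 * 2 ^ ((r + 1) / 2) + 2) + 1))))))))))))))))) ?_
    (by nlinarith)
  refine Run.sub (Run.cons (collect_run (S := S) (X := X) (Y := Y) (m := m) (t := t)
    ?_ ?_ ?_ ?_ ?_ ?_ ?_ ?_ ?_) ?_)
  · simp [hr, h0]
  · simp [hr, h7]
  · simp [hr, h8]
  · simp [hr, h11]
  · simp [hr, h12, h7]
  · exact fun i hi => (hk i hi).1
  · exact fun i hi => (hk i hi).2
  · exact fun i hi => S.pow_mem (D.mem i hi) _
  · exact fun i hi => D.pow_two_pow_eq_one hi _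
  rintro s1 ⟨r', i14, ir', i0, i1, ie, ic, io, ir, ia⟩
  obtain rfl : r' = r := by
    rw [ir', hrdef]
    congr 1
    ext i
    simp only [Finset.mem_filter, Finset.mem_range, ne_eq, and_congr_right_iff]
    intro hi
    rw [D.pow_eq_one_iff hi, not_le]
  have ez : s1.arr 0 m = E.encG y := by simp [(io m le_rfl).1, hy]
  have eh : s1.arr 1 m = E.encH h := by simp [(io m le_rfl).2, hh]
  have er : ∀ r < 12, s1.reg r = s₀.reg r := by
    intro r hr'
    simp (disch := omega) [ir, hr]
  have e12 : s1.reg 12 = t := by simp [ir, h12, hr, h7]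
  have e0 : s1.reg 0 = m := by rw [er 0 (by omega), h0]
  refine Run.load (Run.load (Run.cons (iteratedSquare_run (a := y) (t := t) ?_ ?_ ?_ ?_) ?_))
  · simp [er, h7]
  · simp [er, h11]
  · simp [e12]
  · simp [e0, ez]
  rintro s2 ⟨j17, jr, ja⟩
  simp only [RState.arr_setReg] at ja
  have f15 : s2.reg 15 = E.encG y := by simp [jr, e0, ez]
  have f16 : s2.reg 16 = E.encH h := by simp [jr, e0, eh]
  have f14 : s2.reg 14 = r := by simp [jr, i14]
  have f12 : s2.reg 12 = t := by simp [jr, e12]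
  have fr : ∀ r < 12, s2.reg r = s₀.reg r := by
    intro r hr'
    simp (disch := omega) [jr, er]
  refine Run.const (Run.const (Run.half (Run.cons (buildTable_run (S := S) (δ := δ) (t := t)
    (n := r / 2) (i₀ := 0) (w₀ := 0) (c := y ^ 2 ^ t) ?_ ?_ ?_ ?_ ?_ ?_ ?_) ?_)))
  · simp [fr, h7]
  · simp [j17]
  · simp only [RState.reg_setReg_of_ne, ne_eq, Nat.reduceEqDiff, not_false_eq_true, j17, f15, f16]
    exact ⟨y, h, rfl, rfl, rfl, hyt, hS⟩
  · simp
  · simp [f14]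
  · simp
  · intro ρ hρ
    simpa [ja] using ie ρ (by omega)
  rintro s3 ⟨k20, k18, ke, kc, -, ka, kr⟩
  simp only [zero_add, RState.arr_setReg, ja] at k20 k18 ke kc ka
  have g14 : s3.reg 14 = r := by simp [kr, f14]
  have g12 : s3.reg 12 = t := by simp [kr, f12]
  have gr : ∀ r < 12, s3.reg r = s₀.reg r := by
    intro r hr'
    simp (disch := omega) [kr, fr]
  have g6 : s3.arr 6 = s1.arr 6 := ka 6 (by omega)
  have g7 : s3.arr 7 = s1.arr 7 := ka 7 (by omega)
  have g8 : s3.arr 8 = s1.arr 8 := ka 8 (by omega)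
  refine Run.copy (Run.copy (Run.copy (Run.copy (Run.copy (Run.cons (buildTable_run (S := S)
    (δ := 1) (t := t) (n := (r + 1) / 2) (i₀ := r / 2) (w₀ := 2 ^ (r / 2)) (c := 1)
    ?_ ?_ ?_ ?_ ?_ ?_ ?_) ?_)))))
  · simp [gr, h7]
  · simp [gr, h8]
  · refine ⟨1, 1, ?_, ?_, ?_, by simp, ?_⟩
    · simp [gr, h8]
    · simp [gr, h8]
    · simp [gr, h9]
    · rw [mul_one]
      exact S.one_mem
  · simp [k18]
  · simp [g14]
    omega
  · simp [k20]
  · intro ρ hρ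
    simpa [g6, g7, g8] using ie ρ (by omega)
  rintro s4 ⟨l20, l18, le, lc, lo, la, lr⟩
  simp only [RState.arr_setReg] at lo la lc
  rw [g6] at lc
  have p22 : s4.reg 22 = 2 ^ (r / 2) := by simp [lr, k20]
  have p12 : s4.reg 12 = t := by simp [lr, g12]
  have pr : ∀ r < 12, s4.reg r = s₀.reg r := by
    intro r hr'
    simp (disch := omega) [lr, gr]
  refine Run.cons (fillDirectory_run (n := 2 ^ (r / 2)) ?_ p22) ?_
  · simp [pr, h7]
  rintro s5 ⟨m23, md, ma, mr⟩
  have q9 : s5.arr 9 = s4.arr 9 := ma 9 (by omega)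
  have q10 : s5.arr 10 = s4.arr 10 := ma 10 (by omega)
  have q11 : s5.arr 11 = s4.arr 11 := ma 11 (by omega)
  refine Run.cons (scanTable_run (S := S) (δ := δ) (t := t) (n := 2 ^ (r / 2))
    (l := 2 ^ ((r + 1) / 2)) (m := m) ?_ ?_ ?_ ?_ m23 ?_ ?_ ?_ ?_) ?_
  · simp [mr, pr, h0]
  · simp [mr, pr, h7]
  · simp [mr, l20]
  · simp [mr, p22]
  · rwa [q9]
  · intro j hj
    rw [q9, q10, q11, lo 9 j hj, lo 10 j hj, lo 11 j hj]
    exact ke j hj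
  · rwa [q9, q10, q11]
  · -- The target is a product of generators of order two; it is split between the two tables.
    have hz : y ^ 2 ^ t ∈ Subgroup.closure (cells E.encG (s1.arr 6) 0 (r / 2)) ⊔
        Subgroup.closure (cells E.encG (s1.arr 6) (r / 2) (r / 2 + (r + 1) / 2)) := by
      refine D.pow_two_pow_mem hS hyt fun i hi => ?_
      rcases ic i hi with h' | ⟨ρ, h1, h2⟩
      · change X i ^ 2 ^ t ∈ _
        rw [h']
        exact Subgroup.one_mem _
      · rcases lt_or_ge ρ (r / 2) with h3 | h3
        · exact Subgroup.mem_sup_left (Subgroup.subset_closure ⟨ρ, by omega, h3, h2⟩)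
        · exact Subgroup.mem_sup_right (Subgroup.subset_closure ⟨ρ, h3, by omega, h2⟩)
    obtain ⟨v, hv, w, hw, hvw⟩ := Subgroup.mem_sup.1 hz
    obtain ⟨i, hi, hi'⟩ := kc _ (inv_mem hv)
    obtain ⟨j, hj, hj'⟩ := lc _ hw
    refine ⟨i, hi, j, hj, ?_⟩
    rw [q9, hj', lo 9 i hi, hi', ← hvw, mul_comm v w, mul_inv_cancel_right, one_mul]
  rintro s6 ⟨⟨y', h', n0, n1, nt, nS⟩, no, na, nr⟩
  have z0 : ∀ A < 9, s5.arr A = s1.arr A := by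
    intro A hA
    rw [ma A (by omega), la A (by omega), ka A (by omega)]
  refine Run.nil ⟨?_, ?_, ?_, ?_, y', h', n0, n1, nt, nS⟩
  · rw [nr 12 (by omega), mr 12 (by omega), p12]
  · intro r hr'
    rw [nr r (by omega), mr r (by omega), pr r hr']
  · intro A hA hA'
    rw [na A hA, z0 A (by omega), ia A hA hA']
    simp [ha A hA hA']
  · intro i hi
    rw [(no i hi.ne).1, (no i hi.ne).2, z0 0 (by omega), z0 1 (by omega), i0 i hi, i1 i hi]
    have hiff := D.pow_eq_one_iff hi t
    by_cases hc : e i ≤ t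
    · rw [if_pos (hiff.2 hc), if_pos (hiff.2 hc)]
      simp [hX, hY, Nat.sub_eq_zero_of_le hc, Nat.sub_eq_zero_of_le (hc.trans (Nat.le_succ t))]
    · rw [if_neg (mt hiff.1 hc), if_neg (mt hiff.1 hc)]
      have : e i - t = e i - (t + 1) + 1 := by omega
      simp [hX, hY, this, pow_succ, pow_mul]

end Attack

/-! ### Decompositions into cyclic groups -/

namespace IsCyclicDecomposition

variable {A : Type*} [CommGroup A] {n : ℕ} {a : Fin n → A} {S : Subgroup A}

theorem zpow_eq_one (h : IsCyclicDecomposition a S) {c : Fin n → ℤ} (hc : ∏ l, a l ^ c l = 1)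
    (l : Fin n) : a l ^ c l = 1 := by
  refine Subgroup.eq_one_of_noncommProd_eq_one_of_iSupIndep Finset.univ (fun l => a l ^ c l)
    (fun _ _ _ _ _ => Commute.all _ _) (fun l => Subgroup.zpowers (a l)) h.indep
    (fun l _ => Subgroup.zpow_mem _ (Subgroup.mem_zpowers _) _) ?_ l (Finset.mem_univ l)
  rwa [Finset.noncommProd_eq_prod]

theorem mem (h : IsCyclicDecomposition a S) (l : Fin n) : a l ∈ S := by
  rw [← h.iSup_eq]
  exact Subgroup.mem_iSup_of_mem l (Subgroup.mem_zpowers _)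

theorem exists_zpow (h : IsCyclicDecomposition a S) {x : A} (hx : x ∈ S) :
    ∃ c : Fin n → ℤ, x = ∏ l, a l ^ c l := by
  classical
  rw [← h.iSup_eq] at hx
  induction hx using Subgroup.iSup_induction' with
  | hp i x hx =>
    obtain ⟨z, rfl⟩ := hx
    refine ⟨Pi.single i z, ?_⟩
    rw [Finset.prod_eq_single i]
    · simp
    · intro j _ hj
      simp [hj]
    · simp
  | h1 => exact ⟨0, by simp⟩
  | hmul x y _ _ hx hy =>
    obtain ⟨c, rfl⟩ := hx
    obtain ⟨d, rfl⟩ := hy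
    exact ⟨c + d, by simp [zpow_add, Finset.prod_mul_distrib]⟩

theorem exists_pow [Finite A] (h : IsCyclicDecomposition a S) {x : A} (hx : x ∈ S) :
    ∃ c : Fin n → ℕ, (∀ l, c l < orderOf (a l)) ∧ x = ∏ l, a l ^ c l := by
  obtain ⟨c, rfl⟩ := h.exists_zpow hx
  have hpos : ∀ l, (0 : ℤ) < orderOf (a l) := fun l => by exact_mod_cast orderOf_pos (a l)
  refine ⟨fun l => (c l % orderOf (a l)).toNat, fun l => ?_, ?_⟩
  · have := Int.emod_lt_of_pos (c l) (hpos l)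
    have := Int.emod_nonneg (c l) (hpos l).ne'
    dsimp only
    omega
  · refine Finset.prod_congr rfl fun l _ => ?_
    rw [← zpow_natCast, Int.toNat_of_nonneg (Int.emod_nonneg _ (hpos l).ne'), zpow_mod_orderOf]

theorem card_eq [Finite A] (h : IsCyclicDecomposition a S) :
    Nat.card S = ∏ l, orderOf (a l) := by
  let Φ : (∀ l, Fin (orderOf (a l))) → S := fun c =>
    ⟨∏ l, a l ^ (c l : ℕ), Subgroup.prod_mem _ fun l _ => S.pow_mem (h.mem l) _⟩
  have hΦ : Function.Bijective Φ := by
    constructor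
    · intro c d hcd
      have h1 : ∏ l, a l ^ ((c l : ℤ) - (d l : ℤ)) = 1 := by
        simp only [zpow_sub, zpow_natCast, Finset.prod_mul_distrib, Finset.prod_inv_distrib]
        rw [mul_inv_eq_one]
        exact congrArg Subtype.val hcd
      funext l
      have h2 := h.zpow_eq_one h1 l
      rw [zpow_sub, zpow_natCast, zpow_natCast, mul_inv_eq_one] at h2
      exact Fin.ext (pow_injOn_Iio_orderOf (c l).2 (d l).2 h2)
    · rintro ⟨x, hx⟩
      obtain ⟨c, hc, rfl⟩ := h.exists_pow hx
      exact ⟨fun l => ⟨c l, hc l⟩, rfl⟩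
  rw [← Nat.card_congr (Equiv.ofBijective Φ hΦ)]
  simp

end IsCyclicDecomposition

namespace Attack

/-! ### Echelon tables in abelian `2`-groups -/

section Echelon

variable {H : Type*} [CommGroup H]

/-- The subgroup generated by the entries of the table `B` in the occupied cells from `p` on. -/
def tailSpan (occ : Set ℕ) (B : ℕ → H) (p : ℕ) : Subgroup H :=
  Subgroup.closure (B '' {q | q ∈ occ ∧ p ≤ q})

/-- A table is in echelon form with respect to a descending sequence `F` of subgroups: the entry
in an occupied cell `q` lies in `F q` but not in `F (q + 1)`, and its square is generated by the
later entries. -/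
structure IsEchelon (F : ℕ → Subgroup H) (occ : Set ℕ) (B : ℕ → H) : Prop where
  mem : ∀ q ∈ occ, B q ∈ F q
  notMem : ∀ q ∈ occ, B q ∉ F (q + 1)
  sq_mem : ∀ q ∈ occ, B q * B q ∈ tailSpan occ B (q + 1)

variable {F : ℕ → Subgroup H} {occ : Set ℕ} {B : ℕ → H} {p : ℕ} {x : H}

theorem mem_tailSpan {q : ℕ} (hq : q ∈ occ) (hpq : p ≤ q) : B q ∈ tailSpan occ B p :=
  Subgroup.subset_closure ⟨q, ⟨hq, hpq⟩, rfl⟩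

theorem tailSpan_le (hF : Antitone F) (hB : ∀ q ∈ occ, B q ∈ F q) (p : ℕ) :
    tailSpan occ B p ≤ F p := by
  rw [tailSpan, Subgroup.closure_le]
  rintro _ ⟨q, ⟨hq, hpq⟩, rfl⟩
  exact hF hpq (hB q hq)

theorem mem_tailSpan_succ (hsq : p ∈ occ → B p * B p ∈ tailSpan occ B (p + 1))
    (hx : x ∈ tailSpan occ B p) :
    x ∈ tailSpan occ B (p + 1) ∨ p ∈ occ ∧ x * B p ∈ tailSpan occ B (p + 1) := by
  induction hx using Subgroup.closure_induction with
  | mem x hx =>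
    obtain ⟨q, ⟨hq, hpq⟩, rfl⟩ := hx
    rcases hpq.eq_or_lt with rfl | h
    · exact .inr ⟨hq, hsq hq⟩
    · exact .inl (mem_tailSpan hq h)
  | one => exact .inl (one_mem _)
  | mul x y _ _ hx hy =>
    rcases hx with hx | ⟨hp, hx⟩ <;> rcases hy with hy | ⟨hp', hy⟩
    · exact .inl (mul_mem hx hy)
    · exact .inr ⟨hp', by rw [mul_assoc]; exact mul_mem hx hy⟩
    · exact .inr ⟨hp, by rw [mul_right_comm]; exact mul_mem hx hy⟩
    · refine .inl ?_
      have := mul_mem (mul_mem hx hy) (inv_mem (hsq hp))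
      rwa [mul_mul_mul_comm, mul_inv_cancel_right] at this
  | inv x _ hx =>
    rcases hx with hx | ⟨hp, hx⟩
    · exact .inl (inv_mem hx)
    · refine .inr ⟨hp, ?_⟩
      have := mul_mem (inv_mem hx) (hsq hp)
      rwa [mul_inv_rev, mul_comm (B p)⁻¹, mul_assoc, inv_mul_cancel_left] at this

/-- An element spanned by an echelon table can be reduced by the entry in the leading cell. -/
theorem IsEchelon.reduce (hE : IsEchelon F occ B) (hF : Antitone F)
    (hx : x ∈ tailSpan occ B p) :
    (x ∈ F (p + 1) → x ∈ tailSpan occ B (p + 1)) ∧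
      (x ∉ F (p + 1) → p ∈ occ ∧ x * B p ∈ tailSpan occ B (p + 1)) := by
  have hle := tailSpan_le hF hE.mem (p + 1)
  rcases mem_tailSpan_succ (hE.sq_mem p) hx with h | ⟨hp, h⟩
  · exact ⟨fun _ => h, fun h' => absurd (hle h) h'⟩
  · refine ⟨fun h' => ?_, fun _ => ⟨hp, h⟩⟩
    refine absurd ?_ (hE.notMem p hp)
    have := (F (p + 1)).mul_mem ((F (p + 1)).inv_mem h') (hle h)
    rwa [inv_mul_cancel_left] at this

/-- State of the insertion of `x₀` into the echelon table `B₀`, after the cells below `p` have been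
treated: `B` is the present table, `x` what is left of `x₀`, and `grown` tells whether the table
has grown. -/
structure InsertInv (F : ℕ → Subgroup H) (occ₀ : Set ℕ) (B₀ : ℕ → H) (x₀ : H) (p : ℕ)
    (occ : Set ℕ) (B : ℕ → H) (x : H) (grown : Prop) : Prop where
  x_mem : x ∈ F p
  mem : ∀ q ∈ occ, B q ∈ F q
  notMem : ∀ q ∈ occ, B q ∉ F (q + 1)
  sq_mem : ∀ q ∈ occ, p ≤ q → B q * B q ∈ tailSpan occ B (q + 1)
  sq_mem' : ∀ q ∈ occ, q < p → B q * B q ∈ tailSpan occ B (q + 1) ⊔ Subgroup.zpowers x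
  span_eq : tailSpan occ B 0 ⊔ Subgroup.zpowers x = tailSpan occ₀ B₀ 0 ⊔ Subgroup.zpowers x₀
  not_grown : ¬ grown → tailSpan occ B 0 = tailSpan occ₀ B₀ 0
  reduced : x₀ ∈ tailSpan occ₀ B₀ 0 → ¬ grown ∧ occ = occ₀ ∧ B = B₀ ∧ x ∈ tailSpan occ B p

variable {occ₀ : Set ℕ} {B₀ : ℕ → H} {x₀ : H} {grown : Prop}

theorem InsertInv.start (hE : IsEchelon F occ B) (hx : x ∈ F 0) :
    InsertInv F occ B x 0 occ B x False where
  x_mem := hx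
  mem := hE.mem
  notMem := hE.notMem
  sq_mem q hq _ := hE.sq_mem q hq
  sq_mem' q _ h := absurd h (by omega)
  span_eq := rfl
  not_grown _ := rfl
  reduced h := ⟨id, rfl, rfl, h⟩

/-- The digit of the cell `p` vanishes. -/
theorem InsertInv.skip (hE : IsEchelon F occ₀ B₀) (hF : Antitone F)
    (hI : InsertInv F occ₀ B₀ x₀ p occ B x grown) (hx : x ∈ F (p + 1)) :
    InsertInv F occ₀ B₀ x₀ (p + 1) occ B x grown where
  x_mem := hx
  mem := hI.mem
  notMem := hI.notMem
  sq_mem q hq h := hI.sq_mem q hq (by omega)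
  sq_mem' q hq h := by
    rcases Nat.lt_succ_iff_lt_or_eq.1 h with h' | rfl
    · exact hI.sq_mem' q hq h'
    · exact Subgroup.mem_sup_left (hI.sq_mem q hq le_rfl)
  span_eq := hI.span_eq
  not_grown := hI.not_grown
  reduced h := by
    obtain ⟨h1, rfl, rfl, h2⟩ := hI.reduced h
    exact ⟨h1, rfl, rfl, (hE.reduce hF h2).1 hx⟩

theorem sup_zpowers_mul {V : Subgroup H} {b : H} (hb : b ∈ V) (x : H) :
    V ⊔ Subgroup.zpowers (x * b) = V ⊔ Subgroup.zpowers x := by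
  have key : ∀ (x b : H), b ∈ V → V ⊔ Subgroup.zpowers (x * b) ≤ V ⊔ Subgroup.zpowers x := by
    intro x b hb
    refine sup_le le_sup_left ?_
    rw [Subgroup.zpowers_le]
    exact mul_mem (Subgroup.mem_sup_right (Subgroup.mem_zpowers x)) (Subgroup.mem_sup_left hb)
  refine le_antisymm (key x b hb) ?_
  simpa using key (x * b) b⁻¹ (inv_mem hb)

/-- The digit of the cell `p` does not vanish, and the cell is occupied. -/
theorem InsertInv.reduce (hE : IsEchelon F occ₀ B₀) (hF : Antitone F)
    (hI : InsertInv F occ₀ B₀ x₀ p occ B x grown) (hx : x ∉ F (p + 1)) (hp : p ∈ occ)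
    (hxB : x * B p ∈ F (p + 1)) :
    InsertInv F occ₀ B₀ x₀ (p + 1) occ B (x * B p) grown where
  x_mem := hxB
  mem := hI.mem
  notMem := hI.notMem
  sq_mem q hq h := hI.sq_mem q hq (by omega)
  sq_mem' q hq h := by
    rcases Nat.lt_succ_iff_lt_or_eq.1 h with h' | rfl
    · rw [sup_zpowers_mul (mem_tailSpan hp (by omega))]
      exact hI.sq_mem' q hq h'
    · exact Subgroup.mem_sup_left (hI.sq_mem q hq le_rfl)
  span_eq := by
    rw [sup_zpowers_mul (mem_tailSpan hp (by omega)), hI.span_eq]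
  not_grown := hI.not_grown
  reduced h := by
    obtain ⟨h1, rfl, rfl, h2⟩ := hI.reduced h
    exact ⟨h1, rfl, rfl, ((hE.reduce hF h2).2 hx).2⟩

theorem tailSpan_insert (hp : p ∉ occ) (x : H) {q : ℕ} (hq : q ≤ p) :
    tailSpan (Set.insert p occ) (Function.update B p x) q =
      tailSpan occ B q ⊔ Subgroup.zpowers x := by
  rw [tailSpan, tailSpan, Subgroup.zpowers_eq_closure, ← Subgroup.closure_union]
  congr 1
  ext y
  constructor
  · rintro ⟨r, ⟨hr | hr, hqr⟩, rfl⟩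
    · subst hr
      simp
    · have : r ≠ p := fun h => hp (h ▸ hr)
      exact .inl ⟨r, ⟨hr, hqr⟩, by simp [this]⟩
  · rintro (⟨r, ⟨hr, hqr⟩, rfl⟩ | rfl)
    · have : r ≠ p := fun h => hp (h ▸ hr)
      exact ⟨r, ⟨.inr hr, hqr⟩, by simp [this]⟩
    · exact ⟨p, ⟨.inl rfl, hq⟩, by simp⟩

theorem tailSpan_insert_of_lt (x : H) {q : ℕ} (hq : p < q) :
    tailSpan (Set.insert p occ) (Function.update B p x) q = tailSpan occ B q := by
  rw [tailSpan, tailSpan]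
  congr 1
  ext y
  constructor
  · rintro ⟨r, ⟨hr | hr, hqr⟩, rfl⟩
    · omega
    · exact ⟨r, ⟨hr, hqr⟩, by simp [show r ≠ p by omega]⟩
  · rintro ⟨r, ⟨hr, hqr⟩, rfl⟩
    exact ⟨r, ⟨.inr hr, hqr⟩, by simp [show r ≠ p by omega]⟩

/-- The digit of the cell `p` does not vanish, and the cell is empty. -/
theorem InsertInv.grow (hE : IsEchelon F occ₀ B₀) (hF : Antitone F)
    (hI : InsertInv F occ₀ B₀ x₀ p occ B x grown) (hx : x ∉ F (p + 1)) (hp : p ∉ occ)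
    (hxB : x * x ∈ F (p + 1)) :
    InsertInv F occ₀ B₀ x₀ (p + 1) (Set.insert p occ) (Function.update B p x) (x * x) True where
  x_mem := hxB
  mem q hq := by
    rcases eq_or_ne q p with rfl | h
    · simpa using hI.x_mem
    · simpa [h] using hI.mem q (hq.resolve_left h)
  notMem q hq := by
    rcases eq_or_ne q p with rfl | h
    · simpa using hx
    · simpa [h] using hI.notMem q (hq.resolve_left h)
  sq_mem q hq h := by
    rw [tailSpan_insert_of_lt x (by omega)]
    simpa [show q ≠ p by omega] using
      hI.sq_mem q (hq.resolve_left (show q ≠ p by omega)) (by omega)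
  sq_mem' q hq h := by
    rcases Nat.lt_succ_iff_lt_or_eq.1 h with h' | rfl
    · rw [tailSpan_insert hp x (by omega)]
      simpa [h'.ne] using Subgroup.mem_sup_left (hI.sq_mem' q (hq.resolve_left h'.ne) h')
    · simpa using Subgroup.mem_sup_right (Subgroup.mem_zpowers (x * x))
  span_eq := by
    rw [tailSpan_insert hp x (by omega), sup_zpowers_mul, ← hI.span_eq, sup_assoc, sup_idem]
    exact Subgroup.mem_sup_right (Subgroup.mem_zpowers x)
  not_grown h := absurd trivial h
  reduced h := by
    obtain ⟨h1, rfl, rfl, h2⟩ := hI.reduced h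
    exact absurd ((hE.reduce hF h2).2 hx).1 hp

/-- After the last cell nothing is left of `x₀`, and the table has grown unless `x₀` was spanned
by it before. -/
theorem InsertInv.isEchelon {M : ℕ} (hF : F M = ⊥)
    (hI : InsertInv F occ₀ B₀ x₀ M occ B x grown) :
    IsEchelon F occ B ∧ tailSpan occ B 0 = tailSpan occ₀ B₀ 0 ⊔ Subgroup.zpowers x₀ ∧
      (grown ↔ x₀ ∉ tailSpan occ₀ B₀ 0) := by
  have hx : x = 1 := by simpa [hF] using hI.x_mem
  subst hx
  have hspan := hI.span_eq
  rw [Subgroup.zpowers_one_eq_bot, sup_bot_eq] at hspan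
  refine ⟨⟨hI.mem, hI.notMem, fun q hq => ?_⟩, hspan, fun hg h => (hI.reduced h).1 hg, ?_⟩
  · rcases lt_or_ge q M with h | h
    · simpa using hI.sq_mem' q hq h
    · exact hI.sq_mem q hq h
  · intro h
    by_contra hg
    apply h
    rw [← hI.not_grown hg, hspan]
    exact Subgroup.mem_sup_right (Subgroup.mem_zpowers x₀)

end Echelon

/-! ### The filtration by leading binary digits of the coordinates -/

section Filtration

variable {H : Type*} [CommGroup H] {k : ℕ} {a : Fin k → H} {f : ℕ → ℕ} {Q : Subgroup H}

/-- The binary digits of the coordinates of an element `∏ a l ^ c l` are numbered consecutively,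
those of `c l` beginning with `∑ i < l, f i`. The subgroup consists of the elements whose first
`p` digits can be taken to vanish. The subtraction is truncated, so coordinates whose digits come
later are unrestricted. If `a l` has order `2 ^ f l`, then the coordinates whose digits come earlier
are divisible by that order, and so do not contribute to the product. -/
def digitFiltration (a : Fin k → H) (f : ℕ → ℕ) (p : ℕ) : Subgroup H where
  carrier := {x | ∃ c : Fin k → ℤ, x = ∏ l, a l ^ c l ∧
    ∀ l : Fin k, (2 : ℤ) ^ (p - ∑ i ∈ Finset.range l, f i) ∣ c l}
  one_mem' := ⟨0, by simp, by simp⟩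
  mul_mem' := by
    rintro _ _ ⟨c, rfl, hc⟩ ⟨d, rfl, hd⟩
    exact ⟨c + d, by simp [zpow_add, Finset.prod_mul_distrib], fun l => dvd_add (hc l) (hd l)⟩
  inv_mem' := by
    rintro _ ⟨c, rfl, hc⟩
    exact ⟨-c, by simp, fun l => (dvd_neg.2 (hc l))⟩

theorem digitFiltration_antitone : Antitone (digitFiltration a f) := by
  rintro p q hpq x ⟨c, hx, hc⟩
  exact ⟨c, hx, fun l => (pow_dvd_pow 2 (by omega)).trans (hc l)⟩

theorem mem_digitFiltration_zero (h : IsCyclicDecomposition a Q) {x : H} (hx : x ∈ Q) :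
    x ∈ digitFiltration a f 0 := by
  obtain ⟨c, hc⟩ := h.exists_zpow hx
  exact ⟨c, hc, by simp⟩

theorem digitFiltration_le (h : IsCyclicDecomposition a Q) (p : ℕ) :
    digitFiltration a f p ≤ Q := by
  rintro _ ⟨c, rfl, -⟩
  exact Subgroup.prod_mem _ fun l _ => Q.zpow_mem (h.mem l) _

theorem sum_range_add_le (f : ℕ → ℕ) {i j : ℕ} (h : i < j) :
    ∑ l ∈ Finset.range i, f l + f i ≤ ∑ l ∈ Finset.range j, f l := by
  rw [← Finset.sum_range_succ]
  exact Finset.sum_le_sum_of_subset (Finset.range_subset_range.2 h)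

theorem zpow_eq_one_of_dvd {b : H} {e e' : ℕ} (hb : orderOf b = 2 ^ e) (h : e ≤ e') {c : ℤ}
    (hc : (2 : ℤ) ^ e' ∣ c) : b ^ c = 1 := by
  rw [← orderOf_dvd_iff_zpow_eq_one, hb]
  push_cast
  exact (pow_dvd_pow 2 h).trans hc

theorem digitFiltration_eq_bot (hf : ∀ l : Fin k, orderOf (a l) = 2 ^ f l) {p : ℕ}
    (hp : ∑ i ∈ Finset.range k, f i ≤ p) : digitFiltration a f p = ⊥ := by
  rw [eq_bot_iff]
  rintro _ ⟨c, rfl, hc⟩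
  rw [Subgroup.mem_bot]
  refine Finset.prod_eq_one fun l _ => zpow_eq_one_of_dvd (hf l) ?_ (hc l)
  have := sum_range_add_le f l.2
  omega

theorem dvd_sub_of_prod_eq (h : IsCyclicDecomposition a Q)
    (hf : ∀ l : Fin k, orderOf (a l) = 2 ^ f l) {c d : Fin k → ℤ}
    (hcd : ∏ l, a l ^ c l = ∏ l, a l ^ d l) (l : Fin k) : (2 : ℤ) ^ f l ∣ c l - d l := by
  have h1 : ∏ l, a l ^ (c - d) l = 1 := by
    simp only [Pi.sub_apply, zpow_sub, Finset.prod_mul_distrib, Finset.prod_inv_distrib]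
    rw [mul_inv_eq_one, hcd]
  have h2 := h.zpow_eq_one h1 l
  rw [← orderOf_dvd_iff_zpow_eq_one, hf l] at h2
  exact_mod_cast h2

/-- Whether the next digit of an element of the filtration vanishes can be read off any of its
coordinate vectors. -/
theorem digitFiltration_step (h : IsCyclicDecomposition a Q)
    (hf : ∀ l : Fin k, orderOf (a l) = 2 ^ f l) {j : Fin k} {e : ℕ} (he : e < f j)
    {d : Fin k → ℤ}
    (hd : ∏ l, a l ^ d l ∈ digitFiltration a f (∑ i ∈ Finset.range j, f i + e)) :
    (2 : ℤ) ^ e ∣ d j ∧ (∏ l, a l ^ d l ∈ digitFiltration a f (∑ i ∈ Finset.range j, f i + e + 1) ↔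
      (2 : ℤ) ^ (e + 1) ∣ d j) := by
  have key : ∀ {e' : ℕ} {c : Fin k → ℤ}, e' ≤ f j → ∏ l, a l ^ d l = ∏ l, a l ^ c l →
      ((2 : ℤ) ^ e' ∣ d j ↔ (2 : ℤ) ^ e' ∣ c j) := by
    intro e' c he' hcd
    exact (dvd_iff_dvd_of_dvd_sub ((pow_dvd_pow 2 he').trans (dvd_sub_of_prod_eq h hf hcd j)))
  obtain ⟨c, hdc, hc⟩ := hd
  refine ⟨?_, ?_, ?_⟩
  · rw [key he.le hdc]
    simpa using hc j
  · rintro ⟨c', hdc', hc'⟩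
    rw [key he hdc']
    have := hc' j
    rwa [show ∑ i ∈ Finset.range j, f i + e + 1 - ∑ i ∈ Finset.range j, f i = e + 1 by omega]
      at this
  · intro hj
    rw [key he hdc] at hj
    refine ⟨fun l => if l < j then 0 else c l, ?_, fun l => ?_⟩
    · rw [hdc]
      refine Finset.prod_congr rfl fun l _ => ?_
      dsimp only
      split_ifs with hl
      · rw [zpow_zero]
        refine zpow_eq_one_of_dvd (hf l) ?_ (hc l)
        have := sum_range_add_le f (Fin.lt_def.1 hl)
        omega
      · rfl
    · dsimp only
      split_ifs with hl
      · exact dvd_zero _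
      · rcases (not_lt.1 hl).eq_or_lt with rfl | hl'
        · rwa [show ∑ i ∈ Finset.range j, f i + e + 1 - ∑ i ∈ Finset.range j, f i = e + 1 by omega]
        · have := sum_range_add_le f (Fin.lt_def.1 hl')
          rw [Nat.sub_eq_zero_of_le (by omega), pow_zero]
          exact one_dvd _

/-- The factors of the filtration have order at most `2`. -/
theorem mul_mem_digitFiltration_succ (h : IsCyclicDecomposition a Q)
    (hf : ∀ l : Fin k, orderOf (a l) = 2 ^ f l) {j : Fin k} {e : ℕ} (he : e < f j) {x y : H}
    (hx : x ∈ digitFiltration a f (∑ i ∈ Finset.range j, f i + e))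
    (hx' : x ∉ digitFiltration a f (∑ i ∈ Finset.range j, f i + e + 1))
    (hy : y ∈ digitFiltration a f (∑ i ∈ Finset.range j, f i + e))
    (hy' : y ∉ digitFiltration a f (∑ i ∈ Finset.range j, f i + e + 1)) :
    x * y ∈ digitFiltration a f (∑ i ∈ Finset.range j, f i + e + 1) := by
  have hxy := mul_mem hx hy
  obtain ⟨c, rfl, -⟩ := id hx
  obtain ⟨d, rfl, -⟩ := id hy
  have hcd : (∏ l, a l ^ c l) * ∏ l, a l ^ d l = ∏ l, a l ^ (c + d) l := by
    simp [zpow_add, Finset.prod_mul_distrib]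
  rw [hcd] at hxy ⊢
  obtain ⟨h1, h2⟩ := digitFiltration_step h hf he hx
  obtain ⟨h3, h4⟩ := digitFiltration_step h hf he hy
  rw [(digitFiltration_step h hf he hxy).2]
  rw [h2] at hx'
  rw [h4] at hy'
  obtain ⟨u, hu⟩ := h1
  obtain ⟨v, hv⟩ := h3
  have hpow : (2 : ℤ) ^ e ≠ 0 := by positivity
  rw [hu, pow_succ, mul_dvd_mul_iff_left hpow] at hx'
  rw [hv, pow_succ, mul_dvd_mul_iff_left hpow] at hy'
  rw [Pi.add_apply, hu, hv, ← mul_add, pow_succ, mul_dvd_mul_iff_left hpow]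
  omega

end Filtration

end Attack

namespace Attack

variable {G H : Type*} [CommGroup G] [CommGroup H] {E : GroupAccess G H}

/-! ### The membership test -/

/-- The arrays `4` and `5` of a state hold the table `B` with the set `occ` of occupied cells. -/
def HoldsTable (E : GroupAccess G H) (s : RState) (occ : Set ℕ) (B : ℕ → H) : Prop :=
  ∀ q, (q ∈ occ ↔ s.arr 5 q = 1) ∧ (q ∈ occ → s.arr 4 q = E.encH (B q))

theorem halving_run {s : RState} {c e : ℕ} (h7 : s.reg 7 = 1) (h19 : s.reg 19 = c)
    (h20 : s.reg 20 = 2 ^ e) :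
    Run E (.loop (.lt 7 20) (block [.half 19 19, .half 20 20])) s (4 * e + 1)
      (fun s' => s'.reg 19 = c / 2 ^ e ∧ (∀ r, r ≠ 19 → r ≠ 20 → s'.reg r = s.reg r) ∧
        s'.arr = s.arr) := by
  refine Run.mono (Run.loop_count_const (fun i s' => s'.reg 19 = c / 2 ^ i ∧
    s'.reg 20 = 2 ^ (e - i) ∧ (∀ r, r ≠ 19 → r ≠ 20 → s'.reg r = s.reg r) ∧ s'.arr = s.arr)
    3 e ?_ ?_ ?_) (by omega) ?_
  · rintro i s1 hi ⟨-, i20, ir, -⟩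
    rw [RTest.holds_lt, i20, ir 7 (by omega) (by omega), h7, Nat.one_lt_two_pow_iff]
    omega
  · rintro i s1 hi ⟨i19, i20, ir, ia⟩
    refine Run.half (Run.half (Run.nil ⟨?_, ?_, ?_, by simp [ia]⟩))
    · simp [i19, Nat.div_div_eq_div_mul, pow_succ]
    · obtain ⟨d, hd⟩ : ∃ d, e - i = d + 1 := ⟨e - i - 1, by omega⟩
      simp [i20, hd, show e - (i + 1) = d by omega, pow_succ]
    · intro r h1 h2
      simp [h1, h2, ir]
  · exact ⟨by simp [h19], by simp [h20], fun _ _ _ => rfl, rfl⟩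
  · rintro s' ⟨i19, -, ir, ia⟩
    exact ⟨i19, ir, ia⟩

/-- The test of the program for the digit of weight `2 ^ e`. -/
theorem half_add_half_lt_iff {c e : ℕ} (h : 2 ^ e ∣ c) :
    c / 2 ^ e / 2 + c / 2 ^ e / 2 < c / 2 ^ e ↔ ¬ 2 ^ (e + 1) ∣ c := by
  obtain ⟨u, rfl⟩ := h
  rw [Nat.mul_div_cancel_left u (by positivity), pow_succ,
    Nat.mul_dvd_mul_iff_left (by positivity)]
  omega

variable {f : ℕ → ℕ} {Q : Subgroup H} [Finite H]

theorem insert_run {s : RState} {occ₀ : Set ℕ} {B₀ : ℕ → H} {x₀ : H} {L : ℕ}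
    (hQ : IsCyclicDecomposition E.gen Q)
    (hf : ∀ l : Fin E.k, orderOf (E.gen l) = 2 ^ f l) (hf0 : ∀ l < E.k, 0 < f l)
    (hfL : ∀ l < E.k, f l ≤ L)
    (h1 : s.reg 1 = E.k) (h7 : s.reg 7 = 1) (h14 : s.reg 14 = E.encH x₀)
    (h3 : ∀ l < E.k, s.arr 3 l = 2 ^ f l) (hx : x₀ ∈ Q) (hT : HoldsTable E s occ₀ B₀)
    (hE : IsEchelon (digitFiltration E.gen f) occ₀ B₀) :
    Run E insert s ((∑ i ∈ Finset.range E.k, f i) * (E.coordCost + 4 * L + 25) + 6)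
      (fun s' => ∃ occ B, HoldsTable E s' occ B ∧ IsEchelon (digitFiltration E.gen f) occ B ∧
        tailSpan occ B 0 = tailSpan occ₀ B₀ 0 ⊔ Subgroup.zpowers x₀ ∧
        (x₀ ∈ tailSpan occ₀ B₀ 0 → s'.reg 15 = 0) ∧
        (x₀ ∉ tailSpan occ₀ B₀ 0 → s'.reg 15 = 1) ∧
        (∀ r < 14, s'.reg r = s.reg r) ∧ ∀ A < 4, s'.arr A = s.arr A) := by
  set F := digitFiltration E.gen f with hF
  have hanti : Antitone F := digitFiltration_antitone
  set M := ∑ i ∈ Finset.range E.k, f i with hM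
  refine Run.le (T := 1 + (1 + (1 + (1 + ((M * (E.coordCost + 4 * L + 24 + 1) + 1) + 1))))) ?_
    (le_of_eq (by ring))
  refine Run.const (Run.const (Run.const (Run.const (Run.cons (Run.loop_count_const (fun p s' =>
    (∃ j e, s'.reg 16 = j ∧ s'.reg 17 = 2 ^ e ∧ p = ∑ i ∈ Finset.range j, f i + e ∧
      (j < E.k ∧ e < f j ∨ j = E.k ∧ e = 0)) ∧ s'.reg 18 = p ∧
    (∃ occ B x, HoldsTable E s' occ B ∧ s'.reg 14 = E.encH x ∧
      (s'.reg 15 = 0 ∨ s'.reg 15 = 1) ∧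
      InsertInv F occ₀ B₀ x₀ p occ B x (s'.reg 15 = 1)) ∧
    (∀ r < 14, s'.reg r = s.reg r) ∧ ∀ A < 4, s'.arr A = s.arr A)
    (E.coordCost + 4 * L + 24) M ?_ ?_ ?_) ?_))))
  · rintro p s1 hp ⟨⟨j, e, i16, -, hpe, hj⟩, -, -, ir, -⟩
    rw [RTest.holds_lt, i16, ir 1 (by omega), h1]
    rcases hj with ⟨hj, he⟩ | ⟨rfl, rfl⟩
    · have := sum_range_add_le f hj
      omega
    · omega
  · rintro p s1 hp ⟨⟨j, e, i16, i17, hpe, hj⟩, i18, ⟨occ, B, x, iT, i14, i15, hI⟩, ir, ia⟩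
    have hje : j < E.k ∧ e < f j := by
      rcases hj with hj | ⟨rfl, rfl⟩
      · exact hj
      · omega
    obtain ⟨hj, he⟩ := hje
    have heL : e ≤ L := he.le.trans (hfL j hj)
    have g7 : s1.reg 7 = 1 := by rw [ir 7 (by omega), h7]
    have g3 : s1.arr 3 j = 2 ^ f j := by rw [ia 3 (by omega), h3 j hj]
    have hxF := hI.x_mem
    obtain ⟨c, hc, hxc⟩ := hQ.exists_pow (digitFiltration_le hQ p hxF)
    have hxz : x = ∏ l, E.gen l ^ ((fun l => (c l : ℤ)) l) := by simpa using hxc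
    have hstep := digitFiltration_step hQ hf (j := ⟨j, hj⟩) he (d := fun l => (c l : ℤ))
      (by rw [← hxz, ← hpe]; exact hxF)
    rw [← hxz, ← hpe, ← hF] at hstep
    obtain ⟨hdvd, hiff⟩ := hstep
    have hdvd : 2 ^ e ∣ c ⟨j, hj⟩ := by exact_mod_cast hdvd
    have hiff : x ∈ F (p + 1) ↔ 2 ^ (e + 1) ∣ c ⟨j, hj⟩ := by
      rw [hiff]
      exact_mod_cast Iff.rfl
    refine Run.le (T := E.coordCost + (1 + ((4 * e + 1) + (1 + (1 + ((9 + 1) + (1 + (1 + (1 +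
      ((3 + 1) + 1)))))))))) ?_ (by omega)
    refine Run.coord ⟨j, hj⟩ c hc (by simp [i16]) (by rw [i14, hxc]) (Run.copy (Run.cons
      (halving_run (c := c ⟨j, hj⟩) (e := e) ?_ ?_ ?_) ?_))
    · simp [g7]
    · simp
    · simp [i17]
    rintro s2 ⟨j19, jr, ja⟩
    simp only [RState.arr_setReg] at ja
    have f14 : s2.reg 14 = E.encH x := by simp [jr, i14]
    have f15 : s2.reg 15 = s1.reg 15 := by simp [jr]
    have f16 : s2.reg 16 = j := by simp [jr, i16]
    have f17 : s2.reg 17 = 2 ^ e := by simp [jr, i17]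
    have f18 : s2.reg 18 = p := by simp [jr, i18]
    have f7 : s2.reg 7 = 1 := by simp [jr, g7]
    have fr : ∀ r < 14, s2.reg r = s.reg r := by
      intro r hr
      simp (disch := omega) [jr, ir]
    refine Run.half (Run.add (Run.cons (Q' := fun s' => s'.reg 16 = j ∧ s'.reg 17 = 2 ^ e ∧
      s'.reg 18 = p ∧ (∃ occ B x, HoldsTable E s' occ B ∧ s'.reg 14 = E.encH x ∧
        (s'.reg 15 = 0 ∨ s'.reg 15 = 1) ∧
        InsertInv F occ₀ B₀ x₀ (p + 1) occ B x (s'.reg 15 = 1)) ∧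
      (∀ r < 14, s'.reg r = s.reg r) ∧ ∀ A < 4, s'.arr A = s.arr A)
      (Run.ite (fun h => ?_) (fun h => ?_)) ?_))
    · have hx' : x ∉ F (p + 1) := by
        rw [hiff, ← half_add_half_lt_iff hdvd]
        simpa [j19] using h
      have hmul : ∀ y ∈ F p, y ∉ F (p + 1) → x * y ∈ F (p + 1) := by
        intro y hy hy'
        subst hpe
        exact mul_mem_digitFiltration_succ hQ hf (j := ⟨j, hj⟩) he hxF hx' hy hy'
      by_cases hp : p ∈ occ
      · refine Run.le (T := 1 + ((4 + 1) + (1 + (1 + 1)))) ?_ (by omega)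
        refine Run.load (Run.cons (Q' := fun s' => s'.arr = s1.arr ∧ ∀ r < 21, s'.reg r = s2.reg r)
          (Run.ite (fun _ => (Run.nil ⟨by simp [ja], fun r hr => by
            simp (disch := omega)⟩).le (show 1 ≤ 4 by omega))
          (fun h' => absurd ?_ h')) ?_)
        · simpa [f18, f7, ja] using (iT p).1.1 hp
        rintro s3 ⟨ka, kr⟩
        refine Run.load (Run.mulH x (B p) ?_ ?_ (Run.nil ⟨?_, ?_, ?_, ⟨occ, B, x * B p,
          ?_, ?_, ?_, ?_⟩, ?_, ?_⟩))
        · simp [kr, f14]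
        · simp [kr, ka, f18, (iT p).2 hp]
        · simp [kr, f16]
        · simp [kr, f17]
        · simp [kr, f18]
        · simpa [HoldsTable, ka] using iT
        · simp
        · simpa [kr, f15] using i15
        · simpa [kr, f15] using hI.reduce hE hanti hx' hp (hmul _ (hI.mem p hp) (hI.notMem p hp))
        · intro r hr
          simp (disch := omega) [kr, fr]
        · intro A hA
          simp [ka, ia A hA]
      · refine Run.le (T := 1 + ((4 + 1) + (1 + (1 + 1)))) ?_ (by omega)
        refine Run.load (Run.cons (Q' := fun s' =>
          s'.arr 4 = Function.update (s1.arr 4) p (E.encH x) ∧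
          s'.arr 5 = Function.update (s1.arr 5) p 1 ∧ (∀ A < 4, s'.arr A = s.arr A) ∧
          s'.reg 15 = 1 ∧ s'.reg 14 = E.encH x ∧ s'.reg 16 = j ∧ s'.reg 17 = 2 ^ e ∧
          s'.reg 18 = p ∧ (∀ r < 14, s'.reg r = s.reg r))
          (Run.ite (fun h' => absurd ?_ (mt (iT p).1.2 hp)) (fun _ => ?_)) ?_)
        · simpa [f18, f7, ja] using h'
        · refine Run.store (Run.store (Run.const (Run.nil ?_)))
          refine ⟨by simp [f18, f14, ja], by simp [f18, f7, ja], ?_, by simp, by simp [f14],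
            by simp [f16], by simp [f17], by simp [f18], ?_⟩
          · intro A hA
            simp (disch := omega) [ja, ia]
          · intro r hr
            simp (disch := omega) [fr]
        rintro s3 ⟨k4, k5, ka, k15, k14, k16, k17, k18, kr⟩
        refine Run.load (Run.mulH x x ?_ ?_ (Run.nil ⟨?_, ?_, ?_, ⟨Set.insert p occ,
          Function.update B p x, x * x, ?_, ?_, ?_, ?_⟩, ?_, ?_⟩))
        · simp [k14]
        · simp [k18, k4]
        · simp [k16]
        · simp [k17]
        · simp [k18]
        · intro q
          simp only [RState.arr_setReg, k4, k5]
          rcases eq_or_ne q p with rfl | hq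
          · simp [Set.insert]
          · simpa [hq, Set.insert] using iT q
        · simp
        · simp [k15]
        · simpa [k15] using hI.grow hE hanti hx' hp (hmul x hxF hx')
        · intro r hr
          simp (disch := omega) [kr]
        · intro A hA
          simp [ka A hA]
    · have hx' : x ∈ F (p + 1) := by
        rw [hiff]
        by_contra h'
        rw [← half_add_half_lt_iff hdvd] at h'
        exact h (by simpa [j19] using h')
      refine (Run.nil ⟨by simp [f16], by simp [f17], by simp [f18], ⟨occ, B, x, ?_, ?_, ?_, ?_⟩,
        ?_, ?_⟩).le (show 1 ≤ 9 by omega)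
      · simpa [HoldsTable, ja] using iT
      · simp [f14]
      · simpa [f15] using i15
      · simpa [f15] using hI.skip hE hanti hx'
      · intro r hr
        simp (disch := omega) [fr]
      · intro A hA
        simp [ja, ia A hA]
    · rintro s3 ⟨k16, k17, k18, ⟨occ', B', x', kT, k14, k15, kI⟩, kr, ka⟩
      have l3 : s3.arr 3 j = 2 ^ f j := by rw [ka 3 (by omega), h3 j hj]
      have l7 : s3.reg 7 = 1 := by rw [kr 7 (by omega), h7]
      refine Run.add (Run.add (Run.load (Run.cons (Q' := fun s' =>
        (∃ j e, s'.reg 16 = j ∧ s'.reg 17 = 2 ^ e ∧ p + 1 = ∑ i ∈ Finset.range j, f i + e ∧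
          (j < E.k ∧ e < f j ∨ j = E.k ∧ e = 0)) ∧ s'.reg 18 = p + 1 ∧
        s'.reg 14 = s3.reg 14 ∧ s'.reg 15 = s3.reg 15 ∧
        (∀ r < 14, s'.reg r = s.reg r) ∧ s'.arr = s3.arr)
        (Run.ite (fun h => ?_) (fun h => ?_)) ?_)))
      · have h2 : e + 1 = f j := by
          have : 2 ^ (e + 1) = 2 ^ f j := by
            simpa [k17, k16, l3, pow_succ, mul_two] using h
          exact Nat.pow_right_injective le_rfl this
        refine Run.const (Run.add (Run.nil ⟨⟨j + 1, 0, ?_, ?_, ?_, ?_⟩, ?_, ?_, ?_, ?_, ?_⟩))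
        · simp [k16, l7]
        · simp
        · rw [Finset.sum_range_succ]
          omega
        · rcases (Nat.succ_le_of_lt hj).lt_or_eq with h4 | h4
          · exact .inl ⟨h4, hf0 _ h4⟩
          · exact .inr ⟨h4, rfl⟩
        · simp [k18, l7]
        · simp
        · simp
        · intro r hr
          simp (disch := omega) [kr]
        · simp
      · have h2 : e + 1 ≠ f j := by
          intro h4
          apply h
          simp [k17, k16, l3, ← h4, pow_succ, mul_two]
        refine (Run.nil ⟨⟨j, e + 1, ?_, ?_, ?_, ?_⟩, ?_, ?_, ?_, ?_, ?_⟩).le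
          (show 1 ≤ 3 by omega)
        · simp [k16]
        · simp [k17, pow_succ, mul_two]
        · omega
        · exact .inl ⟨hj, by omega⟩
        · simp [k18, l7]
        · simp
        · simp
        · intro r hr
          simp (disch := omega) [kr]
        · simp
      · rintro s4 ⟨m1, m18, m14, m15, mr, ma⟩
        refine Run.nil ⟨m1, m18, ⟨occ', B', x', ?_, ?_, ?_, ?_⟩, mr, ?_⟩
        · simpa [HoldsTable, ma] using kT
        · rw [m14, k14]
        · rwa [m15]
        · rwa [m15]
        · intro A hA
          rw [ma, ka A hA]
  · refine ⟨⟨0, 0, by simp, by simp, by simp, ?_⟩, by simp, ⟨occ₀, B₀, x₀, ?_, ?_, ?_, ?_⟩,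
      ?_, ?_⟩
    · rcases Nat.eq_zero_or_pos E.k with h | h
      · exact .inr ⟨h.symm, rfl⟩
      · exact .inl ⟨h, hf0 0 h⟩
    · simpa [HoldsTable] using hT
    · simp [h14]
    · simp
    · simpa using InsertInv.start hE (mem_digitFiltration_zero hQ hx)
    · intro r hr
      simp (disch := omega)
    · intro A hA
      simp
  · rintro s' ⟨-, -, ⟨occ, B, x, iT, -, i15, hI⟩, ir, ia⟩
    obtain ⟨q1, q2, q3⟩ := hI.isEchelon (digitFiltration_eq_bot hf le_rfl)
    refine Run.nil ⟨occ, B, iT, q1, q2, fun h => ?_, fun h => q3.2 h, ir, ia⟩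
    exact i15.resolve_right fun h' => q3.1 h' h

/-- The result tells whether the last element lies in the subgroup generated by the others. -/
theorem siftPhase_run {s : RState} {L m : ℕ} {v : ℕ → H}
    (hQ : IsCyclicDecomposition E.gen Q)
    (hf : ∀ l : Fin E.k, orderOf (E.gen l) = 2 ^ f l) (hf0 : ∀ l < E.k, 0 < f l)
    (hfL : ∀ l < E.k, f l ≤ L)
    (h1 : s.reg 1 = E.k) (h7 : s.reg 7 = 1) (h10 : s.reg 10 = m + 1)
    (h3 : ∀ l < E.k, s.arr 3 l = 2 ^ f l) (h5 : ∀ q, s.arr 5 q = 0)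
    (hv : ∀ i < m + 1, v i ∈ Q) (ha : ∀ i < m + 1, s.arr 1 i = E.encH (v i)) :
    Run E siftPhase s
      ((m + 1) * ((∑ i ∈ Finset.range E.k, f i) * (E.coordCost + 4 * L + 25) + 10) + 4)
      (fun s' => (v m ∈ Subgroup.closure (v '' Set.Iio m) → s'.reg 0 = 0) ∧
        (v m ∉ Subgroup.closure (v '' Set.Iio m) → s'.reg 0 = 1)) := by
  set M := ∑ i ∈ Finset.range E.k, f i
  refine Run.le (T := 1 + (((m + 1) * (M * (E.coordCost + 4 * L + 25) + 9 + 1) + 1) + (1 + 1)))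
    ?_ (le_of_eq (by ring))
  refine Run.const (Run.cons (Run.loop_count_const (fun i s' => s'.reg 13 = i ∧
    (∃ occ B, HoldsTable E s' occ B ∧ IsEchelon (digitFiltration E.gen f) occ B ∧
      tailSpan occ B 0 = Subgroup.closure (v '' Set.Iio i)) ∧
    (i = m + 1 → (v m ∈ Subgroup.closure (v '' Set.Iio m) → s'.reg 15 = 0) ∧
        (v m ∉ Subgroup.closure (v '' Set.Iio m) → s'.reg 15 = 1)) ∧
    (∀ r < 13, s'.reg r = s.reg r) ∧ ∀ A < 4, s'.arr A = s.arr A)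
    (M * (E.coordCost + 4 * L + 25) + 9) (m + 1) ?_ ?_ ?_) ?_)
  · rintro i s1 hi ⟨i13, -, -, ir, -⟩
    simp [i13, ir, h10]
  · rintro i s1 hi ⟨i13, ⟨occ, B, iT, iE, ispan⟩, -, ir, ia⟩
    refine Run.le (T := 1 + ((M * (E.coordCost + 4 * L + 25) + 6) + (1 + 1))) ?_ (by omega)
    refine Run.load (Run.cons (insert_run (x₀ := v i) (occ₀ := occ) (B₀ := B) hQ hf hf0 hfL
      ?_ ?_ ?_ ?_ (hv i hi) ?_ iE) ?_)
    · simp [ir, h1]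
    · simp [ir, h7]
    · simp [i13, ia, ha i hi]
    · simpa [ia] using h3
    · simpa [HoldsTable] using iT
    rintro s2 ⟨occ', B', jT, jE, jspan, j0, j1, jr, ja⟩
    refine Run.add (Run.nil ⟨?_, ⟨occ', B', ?_, jE, ?_⟩, ?_, ?_, ?_⟩)
    · simp [jr, i13, ir, h7]
    · simpa [HoldsTable] using jT
    · rw [jspan, ispan, Subgroup.zpowers_eq_closure, ← Subgroup.closure_union]
      congr 1
      rw [← Order.succ_eq_add_one, Order.Iio_succ_eq_insert, Set.image_insert_eq,
        Set.union_singleton]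
    · intro him
      obtain rfl : i = m := by omega
      rw [ispan] at j0 j1
      simpa using ⟨j0, j1⟩
    · intro r hr
      simp (disch := omega) [jr, ir]
    · intro A hA
      simp [ja A hA, ia A hA]
  · refine ⟨by simp, ⟨∅, fun _ => 1, ?_, ⟨by simp, by simp, by simp⟩, ?_⟩, by simp, ?_, ?_⟩
    · simp [HoldsTable, h5]
    · simp [tailSpan]
    · intro r hr
      simp (disch := omega)
    · simp
  · rintro s1 ⟨-, -, h, -, -⟩
    refine Run.copy (Run.nil ?_)
    simpa using h rfl

end Attack

open Attack

/-! ### Correctness of the attack -/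

namespace Attack.KeyData

variable {G H : Type*} [CommGroup G] [CommGroup H] {S : Subgroup (G × H)} {m : ℕ} {x : ℕ → G}
  {κ : ℕ → H} {e : ℕ → ℕ}

/-- The fibre of `S` over `1` is generated by the powers of the `κ i` whose exponents are the
orders of the `x i`. -/
theorem one_mem_iff (D : KeyData S m x κ e) (h : H) :
    (1, h) ∈ S ↔ h ∈ Subgroup.closure ((fun i => κ i ^ 2 ^ e i) '' Set.Iio m) := by
  constructor
  · intro hh
    obtain ⟨n, hn⟩ := D.exists_eq _ hh
    obtain rfl : h = ∏ i ∈ Finset.range m, κ i ^ n i := congrArg Prod.snd hn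
    have h1 := D.eq_one n (congrArg Prod.fst hn).symm
    refine Subgroup.prod_mem _ fun i hi => ?_
    have hi := Finset.mem_range.1 hi
    have h2 := h1 i hi
    rw [← orderOf_dvd_iff_pow_eq_one, D.orderOf_eq i hi] at h2
    obtain ⟨q, hq⟩ := h2
    rw [hq, pow_mul]
    have h3 : κ i ^ 2 ^ e i ∈ Subgroup.closure ((fun i => κ i ^ 2 ^ e i) '' Set.Iio m) :=
      Subgroup.subset_closure ⟨i, hi, rfl⟩
    exact Subgroup.pow_mem _ h3 _
  · intro hh
    have hle : Subgroup.closure ((fun i => κ i ^ 2 ^ e i) '' Set.Iio m) ≤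
        S.comap (MonoidHom.inr G H) := by
      rw [Subgroup.closure_le]
      rintro _ ⟨i, hi, rfl⟩
      have h1 := S.pow_mem (D.mem i hi) (2 ^ e i)
      have h2 : x i ^ 2 ^ e i = 1 := by rw [← D.orderOf_eq i hi, pow_orderOf_eq_one]
      simpa [h2] using h1
    exact hle hh

end Attack.KeyData

theorem pow_oddPart_mul_mem {A : Type*} [CommGroup A] [Finite A] (Q : Sylow 2 A) (y : A) (n : ℕ) :
    y ^ (oddPart A * n) ∈ (Q : Subgroup A) := by
  have h1 : (Q : Subgroup A).index = oddPart A := by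
    have h2 := (Q : Subgroup A).card_mul_index
    have h3 := Nat.ordProj_mul_ordCompl_eq_self (Nat.card A) 2
    rw [← h3] at h2
    have h4 : Nat.card (Q : Subgroup A) = 2 ^ (Nat.card A).factorization 2 :=
      Q.card_eq_multiplicity
    rw [h4] at h2
    exact Nat.eq_of_mul_eq_mul_left (by positivity) h2
  rw [pow_mul, ← h1]
  exact Subgroup.pow_mem _ (Subgroup.pow_index_mem _ y) _

theorem odd_oddPart (A : Type*) [Group A] [Finite A] : Odd (oddPart A) := by
  rw [← Nat.not_even_iff_odd, even_iff_two_dvd]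
  exact Nat.not_dvd_ordCompl Nat.prime_two Nat.card_pos.ne'

theorem oddPart_le (A : Type*) [Group A] [Finite A] : oddPart A ≤ Nat.card A :=
  Nat.le_of_dvd Nat.card_pos (Nat.ordCompl_dvd _ 2)

theorem pow_oddPart_mul_pow_eq_one {A : Type*} [CommGroup A] [Finite A] (y : A) (n : ℕ) :
    (y ^ (oddPart A * n)) ^ 2 ^ (Nat.card A).factorization 2 = 1 := by
  have h3 := Nat.ordProj_mul_ordCompl_eq_self (Nat.card A) 2
  rw [← pow_mul, mul_right_comm, mul_comm (oddPart A), oddPart, h3, pow_mul, pow_card_eq_one',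
    one_pow]

namespace LHNPKE

variable {G : Type*} {H : Type*} {K : Type*} [CommGroup G] [CommGroup H] [Group K]
  {ξ : PMF G} {χ : PMF H} {m : ℕ}

/-- The public elements of `G`, followed by the first component of the ciphertext. -/
def seqG (I : LHNPKE K ξ χ m) (i : ℕ) : G := if h : i < m then I.g ⟨i, h⟩ else I.cipherG

/-- The second components of the public key, followed by that of the ciphertext. -/
def seqH (I : LHNPKE K ξ χ m) (i : ℕ) : H := if h : i < m then I.key ⟨i, h⟩ else I.cipherH

/-- An odd exponent that maps `G` and `H` to their Sylow `2`-subgroups. -/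
noncomputable def exponent (_ : LHNPKE K ξ χ m) : ℕ := oddPart G * oddPart H

/-- The subgroup of `G × H` generated by the pairs in the public key, raised to the odd exponent
`I.exponent`. -/
noncomputable def keyGroup (I : LHNPKE K ξ χ m) : Subgroup (G × H) :=
  Subgroup.closure ((fun i => (I.seqG i ^ I.exponent, I.seqH i ^ I.exponent)) '' Set.Iio m)

variable (I : LHNPKE K ξ χ m)

theorem map_snd_eq_of_mem_keyGroup {p : G × H} (hp : p ∈ I.keyGroup) :
    I.ψ p.2 = I.ψ (I.φ p.1) := by
  have hle : I.keyGroup ≤ MonoidHom.eqLocus (I.ψ.comp (MonoidHom.snd G H))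
      ((I.ψ.comp I.φ).comp (MonoidHom.fst G H)) := by
    rw [keyGroup, Subgroup.closure_le]
    rintro _ ⟨i, hi, rfl⟩
    have hi' : i < m := hi
    have hker : I.ψ (I.noise ⟨i, hi'⟩) = 1 := I.noise_mem_ker _
    change I.ψ (I.seqH i ^ I.exponent) = I.ψ (I.φ (I.seqG i ^ I.exponent))
    simp [seqG, seqH, hi', key, hker]
  exact hle hp

theorem one_τ_notMem_keyGroup : (1, I.τ) ∉ I.keyGroup := by
  intro h
  have := I.map_snd_eq_of_mem_keyGroup h
  simp only [map_one] at this
  exact I.τ_notMem_ker this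

theorem τ_mul_τ : I.τ * I.τ = 1 := by
  rw [← pow_two, ← I.orderOf_τ, pow_orderOf_eq_one]

/-- The ciphertext is the product of a word in the pairs of the key with `(1, τ ^ β)`, and `τ ^ β`
is its own inverse, and is not affected by the odd exponent. -/
theorem cipher_mem_keyGroup [Finite G] [Finite H] :
    (I.cipherG ^ I.exponent, I.cipherH ^ I.exponent * I.τ ^ (I.β : ℕ)) ∈ I.keyGroup := by
  have hodd : Odd I.exponent := (odd_oddPart G).mul (odd_oddPart H)
  have h1 : ∀ l : List (Fin m),
      ((l.map I.g).prod ^ I.exponent, (l.map I.key).prod ^ I.exponent) ∈ I.keyGroup := by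
    intro l
    induction l with
    | nil =>
      simp only [List.map_nil, List.prod_nil, one_pow]
      exact I.keyGroup.one_mem
    | cons i l ih =>
      have hi : (I.g i ^ I.exponent, I.key i ^ I.exponent) ∈ I.keyGroup :=
        Subgroup.subset_closure ⟨i, i.2, by simp [seqG, seqH]⟩
      simpa [mul_pow] using mul_mem hi ih
  have h2 : I.cipherH ^ I.exponent * I.τ ^ (I.β : ℕ) =
      (I.word.map I.key).prod ^ I.exponent := by
    obtain ⟨q, hq⟩ := hodd
    have h3 : I.τ ^ I.exponent = I.τ := by
      rw [hq, pow_succ, pow_mul, pow_two, τ_mul_τ, one_pow, one_mul]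
    rw [cipherH, mul_pow, ← pow_mul, mul_comm (I.β : ℕ), pow_mul, h3, mul_assoc, ← mul_pow,
      τ_mul_τ, one_pow, mul_one]
  rw [h2]
  exact h1 I.word

variable [Finite G]

/-- The `I.exponent`-th power of a public element of `G` has order `2 ^ I.orderExp i`. -/
noncomputable def orderExp (i : ℕ) : ℕ := Nat.log 2 (orderOf (I.seqG i ^ I.exponent))

theorem orderOf_seqG_pow (i : ℕ) : orderOf (I.seqG i ^ I.exponent) = 2 ^ I.orderExp i := by
  have h1 : orderOf (I.seqG i ^ I.exponent) ∣ 2 ^ (Nat.card G).factorization 2 :=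
    orderOf_dvd_of_pow_eq_one (pow_oddPart_mul_pow_eq_one _ _)
  obtain ⟨e, -, he⟩ := (Nat.dvd_prime_pow Nat.prime_two).1 h1
  rw [orderExp, he, Nat.log_pow (by omega)]

theorem keyData [Finite H] (hI : IsCyclicDecomposition I.g ⊤) :
    KeyData I.keyGroup m (fun i => I.seqG i ^ I.exponent) (fun i => I.seqH i ^ I.exponent)
      I.orderExp where
  mem i hi := Subgroup.subset_closure ⟨i, hi, rfl⟩
  orderOf_eq i _ := I.orderOf_seqG_pow i
  eq_one n hn i hi := by
    have h1 : ∏ l : Fin m, I.g l ^ ((I.exponent * n l : ℕ) : ℤ) = 1 := by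
      rw [Finset.prod_range] at hn
      simpa only [seqG, Fin.is_lt, dif_pos, Fin.eta, zpow_natCast, pow_mul] using hn
    have h2 := hI.zpow_eq_one h1 ⟨i, hi⟩
    simpa only [seqG, hi, dif_pos, zpow_natCast, pow_mul] using h2
  exists_eq p hp := by
    rw [← SetLike.mem_coe, ← Subgroup.coe_toSubmonoid, keyGroup,
      Subgroup.closure_toSubmonoid_of_finite, SetLike.mem_coe] at hp
    induction hp using Submonoid.closure_induction with
    | mem p hp =>
      obtain ⟨i, hi, rfl⟩ := hp
      refine ⟨Pi.single i 1, ?_⟩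
      rw [Finset.prod_eq_single_of_mem i (Finset.mem_range.2 hi),
        Finset.prod_eq_single_of_mem i (Finset.mem_range.2 hi)]
      · simp
      · intro j _ hj
        simp [hj]
      · intro j _ hj
        simp [hj]
    | one => exact ⟨0, by simp [Prod.ext_iff]⟩
    | mul p q _ _ hp hq =>
      obtain ⟨c, rfl⟩ := hp
      obtain ⟨d, rfl⟩ := hq
      exact ⟨c + d, by simp [pow_add, Finset.prod_mul_distrib]⟩

theorem two_pow_le_card (hI : IsCyclicDecomposition I.g ⊤) : 2 ^ m ≤ Nat.card G := by
  have h := hI.card_eq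
  rw [Subgroup.card_top] at h
  have h2 : 2 ^ m = ∏ _i : Fin m, 2 := by simp
  rw [h, h2]
  refine Finset.prod_le_prod' fun i _ => ?_
  have h1 : orderOf (I.g i) ≠ 1 := by
    rw [Ne, orderOf_eq_one_iff]
    exact hI.ne_one i
  have := orderOf_pos (I.g i)
  omega

/-- The orders `2 ^ I.orderExp i` divide those of the `I.g i`, whose product is the order of `G`. -/
theorem two_pow_sum_orderExp_dvd (hI : IsCyclicDecomposition I.g ⊤) :
    2 ^ ∑ i ∈ Finset.range m, I.orderExp i ∣ Nat.card G := by
  have h := hI.card_eq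
  rw [Subgroup.card_top] at h
  rw [h, ← Finset.prod_pow_eq_pow_sum, Finset.prod_range]
  refine Finset.prod_dvd_prod_of_dvd _ _ fun i _ => ?_
  rw [← I.orderOf_seqG_pow]
  simp only [seqG, Fin.is_lt, dif_pos, Fin.eta]
  exact orderOf_pow_dvd _

end LHNPKE

namespace Attack

variable {G H K : Type*} [CommGroup G] [CommGroup H] [Group K]
  {ξ : PMF G} {χ : PMF H} {m : ℕ}

theorem prologue_run (E : GroupAccess G H) (I : LHNPKE K ξ χ m) :
    Run E prologue (attackInput E I) 8 (fun s => (∀ r < 7, s.reg r = (attackInput E I).reg r) ∧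
      s.reg 7 = 1 ∧ s.reg 8 = E.encG 1 ∧ s.reg 9 = E.encH 1 ∧ s.reg 10 = m + 1 ∧
      (∀ r, 11 ≤ r → s.reg r = 0) ∧
      (∀ i < m + 1, s.arr 0 i = E.encG (I.seqG i)) ∧
      (∀ i < m + 1, s.arr 1 i = E.encH (I.seqH i)) ∧
      ∀ A, 2 ≤ A → s.arr A = (attackInput E I).arr A) := by
  have h0 : (attackInput E I).reg 0 = m := rfl
  have h4 : (attackInput E I).reg 4 = E.encH I.τ := rfl
  have h5 : (attackInput E I).reg 5 = E.encG I.cipherG := rfl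
  have h6 : (attackInput E I).reg 6 = E.encH I.cipherH := rfl
  have a0 : (attackInput E I).arr 0 = listArray fun i => E.encG (I.g i) := rfl
  have a1 : (attackInput E I).arr 1 = listArray fun i => E.encH (I.key i) := rfl
  have hr : ∀ r, 11 ≤ r → (attackInput E I).reg r = 0 := by
    intro r hr
    obtain ⟨r, rfl⟩ := Nat.exists_eq_add_of_le' hr
    rfl
  refine Run.le (T := 1 + (1 + (1 + (1 + (1 + (1 + (1 + 1))))))) ?_ (by omega)
  refine Run.const (Run.invG I.cipherG (by simp [h5]) (Run.mulG I.cipherG⁻¹ I.cipherG (by simp)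
    (by simp [h5]) (Run.mulH I.τ I.τ (by simp [h4]) (by simp [h4]) (Run.add (Run.store
    (Run.store (Run.nil ⟨?_, ?_, ?_, ?_, ?_, ?_, ?_, ?_, ?_⟩)))))))
  · intro r hr
    simp (disch := omega)
  · simp
  · simp
  · simp [I.τ_mul_τ]
  · simp [h0]
  · intro r hr'
    simp (disch := omega) [hr r hr']
  · intro i hi
    rcases Nat.lt_succ_iff_lt_or_eq.1 hi with h | rfl
    · simp [h0, h5, a0, listArray, LHNPKE.seqG, h, h.ne]
    · simp [h0, h5, LHNPKE.seqG]
  · intro i hi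
    rcases Nat.lt_succ_iff_lt_or_eq.1 hi with h | rfl
    · simp [h0, h6, a1, listArray, LHNPKE.seqH, h, h.ne]
    · simp [h0, h6, LHNPKE.seqH]
  · intro A hA
    simp (disch := omega)

variable [Finite G] [Finite H]

/-- The running time in terms of an upper bound `L` for the bit lengths of `|G|` and `|H|`. The
number `T` of levels is found by the program. -/
theorem program_run {E : GroupAccess G H} {I : LHNPKE K ξ χ m} {Q : Sylow 2 H} {f : ℕ → ℕ}
    {L : ℕ}
    (hI : IsCyclicDecomposition I.g ⊤) (hQ : IsCyclicDecomposition E.gen (Q : Subgroup H))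
    (hf : ∀ l : Fin E.k, orderOf (E.gen l) = 2 ^ f l)
    (hfL : ∑ i ∈ Finset.range E.k, f i ≤ L) (hG : Nat.card G < 2 ^ L) (hH : Nat.card H < 2 ^ L) :
    ∃ T ≤ m * (L + 1), Run E program (attackInput E I)
      (8 + ((m + 1) * (22 * L + 21) + 2 + (m * (7 * L + 13) + 3 +
        ((T * ((m + 1) * (4 * T + 41) + 1) + 67 * ∑ t ∈ Finset.range T,
          2 ^ ((((Finset.range m).filter fun i => t < I.orderExp i).card + 1) / 2) + 1) +
        ((m + 1) * (L * (E.coordCost + 4 * L + 25) + 10) + 4 + 1)))))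
      (fun s => s.reg 0 = I.β) := by
  have D := I.keyData hI
  have heL : ∀ i, I.orderExp i ≤ L := by
    intro i
    rw [← Nat.pow_le_pow_iff_right (a := 2) (by omega), ← I.orderOf_seqG_pow]
    exact (orderOf_le_card (G := G)).trans hG.le
  have hfL' : ∀ l < E.k, f l ≤ L := fun l hl =>
    (Finset.single_le_sum (fun _ _ => Nat.zero_le _) (Finset.mem_range.2 hl)).trans hfL
  have hf0 : ∀ l < E.k, 0 < f l := by
    intro l hl
    by_contra h
    have h1 := hf ⟨l, hl⟩
    rw [Nat.eq_zero_of_not_pos h, pow_zero, orderOf_eq_one_iff] at h1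
    exact hQ.ne_one _ h1
  obtain ⟨s1, t1, e1, b1, i0, i7, i8, i9, i10, i11, ia0, ia1, ia⟩ := prologue_run E I
  have r1 : Run E prologue (attackInput E I) 8 (· = s1) := ⟨s1, t1, e1, b1, rfl⟩
  obtain ⟨s2, t2, e2, b2, ja0, ja1, jr, ja⟩ := oddPhase_run (E := E) (s := s1) (A := I.seqG)
    (B := I.seqH) (M := oddPart G) (N := oddPart H) (L := L) (n := m + 1) i7 i8 i9 (i11 11 le_rfl)
    (i11 13 (by omega)) (i0 2 (by omega)) (i0 3 (by omega)) i10
    ((oddPart_le G).trans_lt hG) ((oddPart_le H).trans_lt hH) ia0 ia1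
  have r2 : Run E oddPhase s1 _ (· = s2) := ⟨s2, t2, e2, b2, rfl⟩
  obtain ⟨s3, t3, e3, b3, T, k12, hT, kT, kr, ka⟩ := exponentPhase_run (E := E) (s := s2)
    (A := fun i => I.seqG i ^ I.exponent) (L := L) (m := m)
    (by rw [jr 0 (by omega), i0 0 (by omega)]; rfl)
    (by rw [jr 7 (by omega), i7]) (by rw [jr 8 (by omega), i8])
    (by rw [jr 11 (by omega), i11 11 (by omega)]) (by rw [jr 12 (by omega), i11 12 (by omega)])
    (fun i hi => ja0 i (by omega))
    (fun i _ => by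
      rw [← orderOf_dvd_iff_pow_eq_one, I.orderOf_seqG_pow]
      exact pow_dvd_pow 2 (heL i))
  have r3 : Run E exponentPhase s2 _ (· = s3) := ⟨s3, t3, e3, b3, rfl⟩
  -- The number `T` is known only after the first three phases, so these are run beforehand.
  refine ⟨T, hT, Run.cons r1 fun _ h => h ▸ Run.cons r2 fun _ h => h ▸ Run.cons r3
    fun _ h => h ▸ ?_⟩
  have l0 : s3.reg 0 = m := by rw [kr 0 (by omega), jr 0 (by omega), i0 0 (by omega)]; rfl
  have l1 : s3.reg 1 = E.k := by rw [kr 1 (by omega), jr 1 (by omega), i0 1 (by omega)]; rfl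
  have l7 : s3.reg 7 = 1 := by rw [kr 7 (by omega), jr 7 (by omega), i7]
  have l8 : s3.reg 8 = E.encG 1 := by rw [kr 8 (by omega), jr 8 (by omega), i8]
  have l9 : s3.reg 9 = E.encH 1 := by rw [kr 9 (by omega), jr 9 (by omega), i9]
  have l10 : s3.reg 10 = m + 1 := by rw [kr 10 (by omega), jr 10 (by omega), i10]
  have l11 : s3.reg 11 = 0 := by rw [kr 11 (by omega), jr 11 (by omega), i11 11 (by omega)]
  have la : ∀ A, 2 ≤ A → s3.arr A = (attackInput E I).arr A := by
    intro A hA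
    rw [ka, ja A hA, ia A hA]
  have la0 : ∀ i < m + 1, s3.arr 0 i = E.encG (I.seqG i ^ I.exponent) := by
    rw [ka]
    exact ja0
  have la1 : ∀ i < m + 1, s3.arr 1 i = E.encH (I.seqH i ^ I.exponent) := by
    rw [ka]
    exact ja1
  set δ : H := I.τ ^ (I.β : ℕ) with hδ
  have heT : ∀ i < m, I.orderExp i ≤ T := by
    intro i hi
    have := kT i hi
    rwa [← orderOf_dvd_iff_pow_eq_one, I.orderOf_seqG_pow,
      Nat.pow_dvd_pow_iff_le_right (by omega)] at this
  have hcip : (I.seqG m ^ I.exponent, I.seqH m ^ I.exponent * δ) ∈ I.keyGroup := by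
    simpa [LHNPKE.seqG, LHNPKE.seqH] using I.cipher_mem_keyGroup
  have hinit : LevelInv E I.keyGroup m (fun i => I.seqG i ^ I.exponent)
      (fun i => I.seqH i ^ I.exponent) I.orderExp δ s3 T s3 := by
    refine ⟨k12, fun _ _ => rfl, fun _ _ _ => rfl, fun i hi => ?_, _, _, la0 m (by omega),
      la1 m (by omega), ?_, hcip⟩
    · rw [Nat.sub_eq_zero_of_le (heT i hi), pow_zero, pow_one, pow_one]
      exact ⟨la0 i (by omega), la1 i (by omega)⟩
    · obtain ⟨n, hn⟩ := D.exists_eq _ hcip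
      have h1 : I.seqG m ^ I.exponent =
          ∏ i ∈ Finset.range m, (I.seqG i ^ I.exponent) ^ n i := congrArg Prod.fst hn
      rw [h1, ← Finset.prod_pow]
      refine Finset.prod_eq_one fun i hi => ?_
      rw [← pow_mul, mul_comm, pow_mul, kT i (Finset.mem_range.1 hi), one_pow]
  refine Run.cons (Q' := LevelInv E I.keyGroup m (fun i => I.seqG i ^ I.exponent)
      (fun i => I.seqH i ^ I.exponent) I.orderExp δ s3 0) ?_ ?_
  · refine Run.mono (Run.loop_count (fun j => LevelInv E I.keyGroup m
      (fun i => I.seqG i ^ I.exponent) (fun i => I.seqH i ^ I.exponent) I.orderExp δ s3 (T - j))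
      (fun j => (m + 1) * (4 * (T - 1 - j) + 41) + 67 * 2 ^ ((((Finset.range m).filter
        fun i => T - 1 - j < I.orderExp i).card + 1) / 2)) T ?_ ?_ hinit) ?_ ?_
    · rintro j s hj ⟨h12, hr, -⟩
      rw [RTest.holds_lt, h12, hr 11 (by omega), l11]
      omega
    · intro j s hj hs
      rw [show T - j = T - 1 - j + 1 by omega] at hs
      rw [show T - (j + 1) = T - 1 - j by omega]
      exact level_run D l0 l7 l8 l9 l11 hs
    · rw [Finset.sum_range_reflect (fun t => (m + 1) * (4 * t + 41) + 67 * 2 ^ ((((Finset.range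
        m).filter fun i => t < I.orderExp i).card + 1) / 2) + 1), Finset.mul_sum]
      have : ∀ t ∈ Finset.range T, (m + 1) * (4 * t + 41) + 67 * 2 ^ ((((Finset.range
          m).filter fun i => t < I.orderExp i).card + 1) / 2) + 1 ≤
          ((m + 1) * (4 * T + 41) + 1) + 67 * 2 ^ ((((Finset.range
          m).filter fun i => t < I.orderExp i).card + 1) / 2) := by
        intro t ht
        have : (m + 1) * (4 * t + 41) ≤ (m + 1) * (4 * T + 41) :=
          Nat.mul_le_mul_left _ (by have := Finset.mem_range.1 ht; omega)
        omega
      refine Nat.add_le_add_right ((Finset.sum_le_sum this).trans_eq ?_) 1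
      rw [Finset.sum_add_distrib]
      simp
    · simp
  rintro s4 ⟨-, mr, ma, mk, y, h, my, mh, my1, mS⟩
  obtain rfl : y = 1 := by simpa using my1
  set W := Subgroup.closure ((fun i => (I.seqH i ^ I.exponent) ^ 2 ^ I.orderExp i) '' Set.Iio m)
    with hW
  have hhW : h * δ ∈ W := (D.one_mem_iff _).1 mS
  have hτW : I.τ ∉ W := fun h' => I.one_τ_notMem_keyGroup ((D.one_mem_iff _).2 h')
  have hκQ : ∀ i, I.seqH i ^ I.exponent ∈ (Q : Subgroup H) := by
    intro i
    rw [LHNPKE.exponent, mul_comm]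
    exact pow_oddPart_mul_mem Q _ _
  have hWQ : W ≤ (Q : Subgroup H) := by
    rw [hW, Subgroup.closure_le]
    rintro _ ⟨i, -, rfl⟩
    exact Subgroup.pow_mem _ (hκQ i) _
  have hτQ : I.τ ∈ (Q : Subgroup H) := by
    obtain ⟨q, hq⟩ := odd_oddPart H
    have := pow_oddPart_mul_mem Q I.τ 1
    rwa [mul_one, hq, pow_succ, pow_mul, pow_two, I.τ_mul_τ, one_pow, one_mul] at this
  have hhQ : h ∈ (Q : Subgroup H) := by
    have := mul_mem (hWQ hhW) (inv_mem (Subgroup.pow_mem _ hτQ (I.β : ℕ)))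
    rwa [mul_inv_cancel_right] at this
  set vv : ℕ → H := fun i => if i < m then (I.seqH i ^ I.exponent) ^ 2 ^ I.orderExp i else h
    with hvv
  have hvm : vv m = h := by simp [hvv]
  have himg : vv '' Set.Iio m =
      (fun i => (I.seqH i ^ I.exponent) ^ 2 ^ I.orderExp i) '' Set.Iio m :=
    Set.image_congr fun i hi => if_pos hi
  have hsift := siftPhase_run (E := E) (s := s4) (L := L) (m := m) (v := vv) hQ hf hf0 hfL'
    (by rw [mr 1 (by omega), l1]) (by rw [mr 7 (by omega), l7]) (by rw [mr 10 (by omega), l10])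
    (fun l hl => by
      rw [ma 3 (by omega) (by omega), la 3 (by omega)]
      change listArray (fun j => orderOf (E.gen j)) l = _
      simp [listArray, hl, hf])
    (fun q => by
      rw [ma 5 (by omega) (by omega), la 5 (by omega)]
      rfl)
    (fun i hi => by
      rw [hvv]
      dsimp only
      split_ifs
      · exact Subgroup.pow_mem _ (hκQ i) _
      · exact hhQ)
    (fun i hi => by
      rcases Nat.lt_succ_iff_lt_or_eq.1 hi with h' | rfl
      · simp [hvv, h', (mk i h').2]
      · rw [hvm, mh])
  rw [hvm, himg, ← hW] at hsift
  refine Run.cons (hsift.mono ?_ fun s' h' => h') ?_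
  · gcongr
  · rintro s5 ⟨q0, q1⟩
    refine Run.nil ?_
    have hβ : (I.β : ℕ) = 0 ∨ (I.β : ℕ) = 1 := by omega
    rcases hβ with hβ | hβ
    · rw [hδ, hβ] at hhW
      rw [hβ]
      exact q0 (by simpa using hhW)
    · rw [hδ, hβ] at hhW
      rw [hβ]
      refine q1 fun h' => hτW ?_
      have := mul_mem (inv_mem h') hhW
      simpa using this

/-! ### The running time -/

theorem add_one_sq_le (d : ℕ) : (1 + d) ^ 2 ≤ 4 * 2 ^ d := by
  induction d with
  | zero => simp
  | succ d ih =>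
    rcases Nat.lt_or_ge d 2 with h | h
    · interval_cases d <;> norm_num
    · rw [pow_succ 2 d]
      nlinarith

/-- The function `2 ^ (r / 2) / r` is increasing up to a constant factor. The exponent on the left
is rounded; the summand `1` is needed for `r = 0`. -/
theorem two_pow_half_le {r m : ℕ} (hm : 0 < m) (hr : r ≤ m) :
    (2 : ℝ) ^ ((r + 1) / 2) ≤ 1 + 3 * (r / m * 2 ^ ((m : ℝ) / 2)) := by
  have hsqrt : ∀ n : ℕ, (2 : ℝ) ^ ((n : ℝ) / 2) = √2 ^ n := by
    intro n
    rw [Real.sqrt_eq_rpow, ← Real.rpow_natCast, ← Real.rpow_mul (by norm_num)]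
    congr 1
    ring
  have h2 : √2 * √2 = 2 := Real.mul_self_sqrt (by norm_num)
  have h1 : 1 ≤ √2 := by
    rw [Real.one_le_sqrt]
    norm_num
  have h3 : √2 ≤ 3 / 2 := by
    rw [Real.sqrt_le_left (by norm_num)]
    norm_num
  rcases Nat.eq_zero_or_pos r with rfl | hr0
  · simp
  obtain ⟨d, rfl⟩ := Nat.exists_eq_add_of_le hr
  rw [hsqrt]
  have h4 : (2 : ℝ) ^ ((r + 1) / 2) ≤ √2 ^ (r + 1) := by
    calc (2 : ℝ) ^ ((r + 1) / 2) = √2 ^ (2 * ((r + 1) / 2)) := by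
          rw [pow_mul, pow_two, h2]
      _ ≤ √2 ^ (r + 1) := pow_le_pow_right₀ h1 (by omega)
  have h5 : (1 + d : ℝ) ≤ 2 * √2 ^ d := by
    refine le_of_sq_le_sq ?_ (by positivity)
    have : ((1 + d : ℕ) : ℝ) ^ 2 ≤ 4 * 2 ^ d := by exact_mod_cast add_one_sq_le d
    calc (1 + d : ℝ) ^ 2 ≤ 4 * 2 ^ d := by exact_mod_cast this
      _ = (2 * √2 ^ d) ^ 2 := by
        rw [mul_pow, ← pow_mul, mul_comm d 2, pow_mul, pow_two √2, h2]
        norm_num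
  have hr1 : (1 : ℝ) ≤ r := by exact_mod_cast hr0
  have h6 : (r + d : ℝ) ≤ r * (2 * √2 ^ d) := by
    have : (r + d : ℝ) ≤ r * (1 + d) := by nlinarith [Nat.cast_nonneg (α := ℝ) d]
    nlinarith
  have h7 : √2 ^ (r + 1) ≤ 3 * (r / (r + d : ℕ) * √2 ^ (r + d)) := by
    have hpos : (0 : ℝ) < r + d := by positivity
    push_cast
    rw [pow_succ, pow_add, div_mul_eq_mul_div, mul_div_assoc', le_div_iff₀ hpos]
    have h8 : 0 < √2 ^ r := by positivity
    have h9 : √2 * (r + d) ≤ 3 / 2 * (r * (2 * √2 ^ d)) :=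
      mul_le_mul h3 h6 hpos.le (by norm_num)
    nlinarith
  linarith

theorem sum_card_filter_le (e : ℕ → ℕ) (m T : ℕ) :
    ∑ t ∈ Finset.range T, ((Finset.range m).filter fun i => t < e i).card ≤
      ∑ i ∈ Finset.range m, e i := by
  simp only [Finset.card_filter]
  rw [Finset.sum_comm]
  refine Finset.sum_le_sum fun i _ => ?_
  rw [← Finset.card_filter]
  refine (Finset.card_le_card (t := Finset.range (e i)) fun t ht => ?_).trans_eq
    (Finset.card_range _)
  simpa using (Finset.mem_filter.1 ht).2

/-- Since at most `m` digits are treated at each level, and the total number of binary digits is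
`∑ i < m, e i`, the cost of all levels is dominated by the case of levels of equal size. -/
theorem sum_two_pow_half_le (e : ℕ → ℕ) {m T : ℕ} (hm : 0 < m) :
    ∑ t ∈ Finset.range T,
      (2 : ℝ) ^ ((((Finset.range m).filter fun i => t < e i).card + 1) / 2) ≤
      T + 3 * ((∑ i ∈ Finset.range m, e i : ℕ) / m * 2 ^ ((m : ℝ) / 2)) := by
  have h1 : ∑ t ∈ Finset.range T,
      (2 : ℝ) ^ ((((Finset.range m).filter fun i => t < e i).card + 1) / 2) ≤
      ∑ t ∈ Finset.range T, (1 + 3 *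
        ((((Finset.range m).filter fun i => t < e i).card : ℝ) / m * 2 ^ ((m : ℝ) / 2))) := by
    refine Finset.sum_le_sum fun t _ => two_pow_half_le hm ?_
    exact (Finset.card_filter_le _ _).trans_eq (Finset.card_range m)
  refine h1.trans ?_
  rw [Finset.sum_add_distrib, ← Finset.mul_sum, ← Finset.sum_mul, ← Finset.sum_div]
  have h2 : (∑ t ∈ Finset.range T, (((Finset.range m).filter fun i => t < e i).card : ℝ)) ≤
      (∑ i ∈ Finset.range m, e i : ℕ) := by
    exact_mod_cast sum_card_filter_le e m T
  simp only [Finset.sum_const, Finset.card_range, nsmul_eq_mul, mul_one]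
  gcongr

/-- The running time without the last term of the bound. The summand `67 * T` stems from the
summands `1` in `two_pow_half_le`. -/
theorem polynomial_bound {L m T c : ℕ} (hL : 1 ≤ L) (hm : m ≤ L) (hT : T ≤ m * (L + 1)) :
    8 + ((m + 1) * (22 * L + 21) + 2 + (m * (7 * L + 13) + 3 +
        ((T * ((m + 1) * (4 * T + 41) + 1) + 1 + 67 * T) +
        ((m + 1) * (L * (c + 4 * L + 25) + 10) + 4 + 1)))) ≤ 600 * L ^ 5 + 2 * L ^ 2 * c := by
  have hT' : T ≤ L * (L + 1) := hT.trans (Nat.mul_le_mul_right _ hm)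
  calc _ ≤ 8 + ((L + 1) * (22 * L + 21) + 2 + (L * (7 * L + 13) + 3 +
        ((L * (L + 1) * ((L + 1) * (4 * (L * (L + 1)) + 41) + 1) + 1 + 67 * (L * (L + 1))) +
        ((L + 1) * (L * (c + 4 * L + 25) + 10) + 4 + 1)))) := by gcongr
    _ ≤ _ := by
      obtain ⟨l, rfl⟩ := Nat.exists_eq_add_of_le' hL
      ring_nf
      nlinarith [Nat.zero_le l, Nat.zero_le (l ^ 2), Nat.zero_le (l ^ 3), Nat.zero_le (l ^ 4),
        Nat.zero_le (l ^ 5), Nat.zero_le (l * c), Nat.zero_le (l ^ 2 * c)]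

end Attack

theorem IsCyclicDecomposition.exists_orderOf_eq {A : Type*} [CommGroup A] [Finite A] {k : ℕ}
    {a : Fin k → A} (Q : Sylow 2 A) (hQ : IsCyclicDecomposition a (Q : Subgroup A)) :
    ∃ f : ℕ → ℕ, (∀ l : Fin k, orderOf (a l) = 2 ^ f l) ∧
      2 ^ ∑ i ∈ Finset.range k, f i ≤ Nat.card A := by
  have h1 : ∀ l : Fin k, ∃ e, orderOf (a l) = 2 ^ e := by
    intro l
    have h2 := Subgroup.orderOf_dvd_natCard (Q : Subgroup A) (hQ.mem l)
    rw [Q.card_eq_multiplicity] at h2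
    obtain ⟨e, -, he⟩ := (Nat.dvd_prime_pow Nat.prime_two).1 h2
    exact ⟨e, he⟩
  choose g hg using h1
  refine ⟨fun i => if h : i < k then g ⟨i, h⟩ else 0, fun l => by simp [hg], ?_⟩
  rw [← Finset.prod_pow_eq_pow_sum, Finset.prod_range]
  simp only [Fin.is_lt, dif_pos, Fin.eta, ← hg]
  rw [← hQ.card_eq]
  exact Subgroup.card_le_card_group _

theorem lt_two_pow_log_max (x y : ℕ) : x < 2 ^ (max (Nat.log 2 x) (Nat.log 2 y) + 1) :=
  (Nat.lt_pow_succ_log_self (by omega) x).trans_le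
    (Nat.pow_le_pow_right (by omega) (Nat.succ_le_succ (le_max_left _ _)))

theorem theorem3 :
    ∃ (p : RProg) (A : ℕ), ∀ a b : ℕ, ∃ C d : ℕ,
      ∀ (G : Type u) (H : Type v) (K : Type w) [CommGroup G] [Finite G] [CommGroup H] [Finite H]
        [Group K] (P : Sylow 2 G) (Q : Sylow 2 H) (ξ : PMF G) (χ : PMF H) (m : ℕ)
        (E : GroupAccess G H) (I : LHNPKE K ξ χ m),
        IsCyclicDecomposition I.g ⊤ →
        IsCyclicDecomposition E.gen (Q : Subgroup H) →
        (E.coordCost : ℝ) ≤ a * Real.logb 2 (Nat.card H) ^ b →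
        ∃ (s : RState) (t : ℕ),
          Exec E p (attackInput E I) s t ∧
          s.reg 0 = I.β ∧
          (t : ℝ) ≤ C * Real.logb 2 (Nat.card G) ^ d + C * Real.logb 2 (Nat.card H) ^ d +
            A * (Real.logb 2 (Nat.card P) / m * 2 ^ ((m : ℝ) / 2)) := by
  -- The constants are `201 = 67 * 3` and `19200 = 600 * 2 ^ 5`, where `L ≤ 2 * Z` below.
  refine ⟨program, 201, fun a b => ⟨19200 + 8 * a, b + 5, ?_⟩⟩
  intro G H K _ _ _ _ _ P Q ξ χ m E I hI hQ hcost
  obtain ⟨f, hf, hfc⟩ := hQ.exists_orderOf_eq Q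
  obtain ⟨L, hLdef⟩ : ∃ L, L = max (Nat.log 2 (Nat.card G)) (Nat.log 2 (Nat.card H)) + 1 :=
    ⟨_, rfl⟩
  have hG : Nat.card G < 2 ^ L := by
    rw [hLdef]
    exact lt_two_pow_log_max _ _
  have hH : Nat.card H < 2 ^ L := by
    rw [hLdef, max_comm]
    exact lt_two_pow_log_max _ _
  have hfL : ∑ i ∈ Finset.range E.k, f i ≤ L :=
    ((Nat.pow_lt_pow_iff_right (by omega)).1 (hfc.trans_lt hH)).le
  have hmL : m ≤ L :=
    ((Nat.pow_lt_pow_iff_right (by omega)).1 ((I.two_pow_le_card hI).trans_lt hG)).le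
  have hL1 : 1 ≤ L := by omega
  obtain ⟨T, hT, s, t, hexec, ht, hs⟩ := program_run hI hQ hf hfL hG hH
  refine ⟨s, t, hexec, hs, ?_⟩
  set X := Real.logb 2 (Nat.card G) with hX
  set Y := Real.logb 2 (Nat.card H) with hY
  set Z := max X Y with hZ
  have hX0 : 0 ≤ X := Real.logb_nonneg (by norm_num) (by exact_mod_cast Nat.card_pos)
  have hY1 : 1 ≤ Y := by
    have h2 : 2 ≤ Nat.card H := by
      rw [← I.orderOf_τ]
      exact orderOf_le_card
    rw [hY, Real.le_logb_iff_rpow_le (by norm_num) (by exact_mod_cast Nat.card_pos),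
      Real.rpow_one]
    exact_mod_cast h2
  have hZ1 : 1 ≤ Z := hY1.trans (le_max_right _ _)
  have hLZ : (L : ℝ) ≤ 2 * Z := by
    have h1 : ((max (Nat.log 2 (Nat.card G)) (Nat.log 2 (Nat.card H)) : ℕ) : ℝ) ≤ Z := by
      rw [Nat.cast_max]
      exact max_le_max (by simpa using Real.natLog_le_logb (Nat.card G) 2)
        (by simpa using Real.natLog_le_logb (Nat.card H) 2)
    rw [hLdef]
    push_cast at h1 ⊢
    linarith
  have hcZ : (E.coordCost : ℝ) ≤ a * Z ^ b := by
    refine hcost.trans ?_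
    gcongr
    exact le_max_right _ _
  have hlev : ∑ t ∈ Finset.range T,
      (2 : ℝ) ^ ((((Finset.range m).filter fun i => t < I.orderExp i).card + 1) / 2) ≤
      T + 3 * (Real.logb 2 (Nat.card P) / m * 2 ^ ((m : ℝ) / 2)) := by
    rcases Nat.eq_zero_or_pos m with rfl | hm
    · -- For `m = 0` there is no level at all.
      obtain rfl : T = 0 := by omega
      simp
    · refine (sum_two_pow_half_le I.orderExp hm).trans ?_
      have h1 : ((∑ i ∈ Finset.range m, I.orderExp i : ℕ) : ℝ) ≤ Real.logb 2 (Nat.card P) := by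
        have h2 := (Nat.prime_two.pow_dvd_iff_le_factorization Nat.card_pos.ne').1
          (I.two_pow_sum_orderExp_dvd hI)
        rw [P.card_eq_multiplicity]
        push_cast
        rw [← Real.rpow_natCast, Real.logb_rpow (by norm_num) (by norm_num)]
        exact_mod_cast h2
      gcongr
  have hpoly := polynomial_bound (c := E.coordCost) hL1 hmL hT
  have ht' : (t : ℝ) ≤ ((600 * L ^ 5 + 2 * L ^ 2 * E.coordCost : ℕ) : ℝ) - 67 * T +
      67 * ∑ t ∈ Finset.range T,
        (2 : ℝ) ^ ((((Finset.range m).filter fun i => t < I.orderExp i).card + 1) / 2) := by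
    have h1 : t + 67 * T ≤ 600 * L ^ 5 + 2 * L ^ 2 * E.coordCost +
        67 * ∑ t ∈ Finset.range T,
          2 ^ ((((Finset.range m).filter fun i => t < I.orderExp i).card + 1) / 2) := by
      omega
    have h2 : ((t + 67 * T : ℕ) : ℝ) ≤ _ := Nat.cast_le.2 h1
    push_cast at h2 ⊢
    linarith
  have hpolyZ : ((600 * L ^ 5 + 2 * L ^ 2 * E.coordCost : ℕ) : ℝ) ≤
      (19200 + 8 * a) * Z ^ (b + 5) := by
    push_cast
    have hZ0 : 0 ≤ Z := by linarith
    calc (600 * (L : ℝ) ^ 5 + 2 * L ^ 2 * E.coordCost)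
        ≤ 600 * (2 * Z) ^ 5 + 2 * (2 * Z) ^ 2 * (a * Z ^ b) := by gcongr
      _ = 19200 * Z ^ 5 + 8 * a * Z ^ (b + 2) := by ring
      _ ≤ 19200 * Z ^ (b + 5) + 8 * a * Z ^ (b + 5) := by
        gcongr <;> first | exact hZ1 | omega
      _ = _ := by ring
  -- Mixed products of the logarithms of `|G|` and `|H|` are powers of their maximum `Z`.
  have hmax : Z ^ (b + 5) ≤ X ^ (b + 5) + Y ^ (b + 5) := by
    have hY0 : 0 ≤ Y := by linarith
    rcases max_choice X Y with h | h
    · rw [hZ, h]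
      exact le_add_of_nonneg_right (by positivity)
    · rw [hZ, h]
      exact le_add_of_nonneg_left (by positivity)
  have h3 := mul_le_mul_of_nonneg_left hmax (show (0 : ℝ) ≤ 19200 + 8 * a by positivity)
  push_cast
  linarith
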